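/- Let $(\Sigma,{\bf p})$ be a probability space with expectation ${\bf E}$ and let $T_{\lambda,\sigma}\in{\rm SL}(2,\mathbb R)$ ($\lambda\in\mathbb R$, $\sigma\in\Sigma$) be measurable in $\sigma$ and smooth in $\lambda$. Assume that for some $r>0$ and some random variable $K$ with ${\bf E}|K|^5<\infty$, the entries of $\partial_\lambda^kT_{\lambda,\sigma}$, $0\le k\le 3$, $|\lambda|\le r$, are bounded in modulus by $K(\sigma)$. Assume that $\lambda=0$ is a critical point, i.e. $T_{0,\sigma}T_{0,\sigma'}=T_{0,\sigma'}T_{0,\sigma}$ and $|{\rm Tr}(T_{0,\sigma})|<2$ for all $\sigma,\sigma'$. Let $M\in{\rm SL}(2,\mathbb R)$ and $\eta_\sigma\in\mathbb R$ be such that $MT_{0,\sigma}M^{-1}=R_{\eta_\sigma}$ (rotation by $\eta_\sigma$) for all $\sigma$, write $$MT_{\lambda,\sigma}M^{-1}=R_{\eta_\sigma}\exp\big(\lambda P_\sigma+\lambda^2Q_\sigma+{\cal O}(\lambda^3)\big),$$ and put $\beta_\sigma=\langle\overline v|P_\sigma|v\rangle$ with $v=\frac1{\sqrt2}\binom{1}{-\imath}$.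 Suppose ${\bf E}(e^{2\imath j\eta_\sigma})\ne1$ for $j=1,2$ and $$D=\frac12\,{\bf E}(|\beta_\sigma|^2)+\Re e\left(\frac{{\bf E}(\beta_\sigma)\,{\bf E}(\overline{\beta_\sigma}\,e^{2\imath\eta_\sigma})}{1-{\bf E}(e^{2\imath\eta_\sigma})}\right)>0 .$$ Write $e_\theta=(\cos\theta,\sin\theta)$ and let ${\cal S}_{\lambda,\sigma}$ be the action $e\mapsto MT_{\lambda,\sigma}M^{-1}e/\|MT_{\lambda,\sigma}M^{-1}e\|$ on the circle $S^1$ of unit vectors of $\mathbb R^2$. A probability measure $\nu$ on $S^1$ is called invariant if $\int f\,d\nu=\int{\bf E}\,f({\cal S}_{\lambda,\sigma}(e))\,d\nu(e)$ for all $f\in C(S^1)$. For $\alpha\in(0,1]$ let $\|f\|_\alpha=\max\{\|f\|_\infty,m_\alpha(f)\}$, where $m_\alpha(f)=\sup_{e,e'}|f(e)-f(e')|/\delta(e,e')^\alpha$ and $\delta(e,e')=\sqrt{1-\langle e|e'\rangle^2}$ (with $0/0=0$ and $a/0=\infty$ for $a>0$, so that $m_\alpha(f)<\infty$ forces $f(-e)=f(e)$),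 and let $C_\alpha(S^1)$ be the space of continuous $f:S^1\to\mathbb C$ with $\|f\|_\alpha<\infty$. Set $({\cal S}f)(e)={\bf E}\,f({\cal S}_{\lambda,\sigma}(e))$ and, for an invariant $\nu$, $({\cal P}f)(e)=\int f\,d\nu$. Then there are constants $c,d,\lambda_0,\kappa,C>0$ with $d\lambda_0\le1$ such that for every $\lambda\in(0,\lambda_0]$ an invariant probability measure exists and, for every invariant probability measure $\nu$, the following holds with $\alpha=d\lambda$. (a) For all $f\in C_\alpha(S^1)$, $$\|({\cal S}^N-{\cal P})f\|_\alpha\le\|f\|_\alpha\,e^{-c\lambda^3N}\quad\text{for all integers }N\ge\kappa/\lambda ,$$ $$\|({\cal S}^N-{\cal P})f\|_\alpha\le(1+C\lambda^2)\,\|f\|_\alpha\,e^{-c\lambda^3N}\quad\text{for all integers }N\ge0 .$$ (b) Let $f:S^1\to\mathbb C$ satisfy $f(-e)=f(e)$, and let $\theta\mapsto f(e_\theta)$ be differentiable with $\max\{\|f\|_\infty,\|\partial_\theta f\|_\infty\}\le B<\infty$. Let $\theta_n={\cal S}_{\lambda,\sigma_n}(\theta_{n-1})$ be the random orbit with any initial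 point $\theta_0\in S^1$ and independent $\sigma_n$ of law ${\bf p}$. Then the series $\sum_{m\ge1}\big({\bf E}f(\theta_m)-\int f\,d\nu\big)$ converges absolutely, and $$\Big|\sum_{m\ge1}\Big({\bf E}f(\theta_m)-\int f\,d\nu\Big)\Big|\le C\,B\,\lambda^{-3}.$$ -/

import Mathlib

open MeasureTheory Complex
open scoped ENNReal Matrix

noncomputable section

/-- The real unimodular group `SL(2,ℝ)`. -/
abbrev SL2R : Type := Matrix.SpecialLinearGroup (Fin 2) ℝ

/-- The circle `S¹` of unit vectors of `ℝ²` with its Euclidean norm. -/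
abbrev UnitCircle : Type := Metric.sphere (0 : EuclideanSpace ℝ (Fin 2)) 1

/-- The unit vector `e_θ = (cos θ, sin θ)`. -/
def unitVec (θ : ℝ) : UnitCircle :=
  ⟨!₂[Real.cos θ, Real.sin θ], by
    simp [EuclideanSpace.norm_eq, Fin.sum_univ_two]⟩

/-- The vector `A e`. -/
def applyVec (A : SL2R) (x : UnitCircle) : EuclideanSpace ℝ (Fin 2) :=
  WithLp.toLp 2 ((A : Matrix (Fin 2) (Fin 2) ℝ) *ᵥ (x : EuclideanSpace ℝ (Fin 2)).ofLp)

theorem applyVec_ne_zero (A : SL2R) (x : UnitCircle) : applyVec A x ≠ 0 := by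
  intro h
  have h1 : (A : Matrix (Fin 2) (Fin 2) ℝ) *ᵥ (x : EuclideanSpace ℝ (Fin 2)).ofLp = 0 := by
    simpa [applyVec] using h
  have h2 : (x : EuclideanSpace ℝ (Fin 2)).ofLp = 0 :=
    Matrix.eq_zero_of_mulVec_eq_zero (by simp) h1
  have h3 : (x : EuclideanSpace ℝ (Fin 2)) = 0 := by simpa using h2
  exact ne_zero_of_mem_unit_sphere x h3

/-- The action `e ↦ A e / ‖A e‖` of `SL(2,ℝ)` on unit vectors. -/
def circleAct (A : SL2R) (x : UnitCircle) : UnitCircle :=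
  ⟨‖applyVec A x‖⁻¹ • applyVec A x, by
    simp [norm_smul, applyVec_ne_zero A x]⟩

/-- The distance `δ(e, e') = √(1 - ⟨e, e'⟩²)`; it vanishes exactly if `e' = ± e`. -/
def circleDist (x y : UnitCircle) : ℝ :=
  Real.sqrt (1 - (inner ℝ (x : EuclideanSpace ℝ (Fin 2)) (y : EuclideanSpace ℝ (Fin 2))) ^ 2)

/-- The Hölder seminorm `m_α(f) = sup |f(e) - f(e')| / δ(e, e')^α`, with values in `[0, ∞]`. Here
`0 / 0 = 0` and `a / 0 = ∞` for `a > 0`, so that it is infinite unless `f(-e) = f(e)`. -/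
def holderSeminorm (α : ℝ) (f : UnitCircle → ℂ) : ℝ≥0∞ :=
  ⨆ (x : UnitCircle) (y : UnitCircle), ‖f x - f y‖ₑ / ENNReal.ofReal (circleDist x y) ^ α

/-- The Hölder norm `‖f‖_α = max {‖f‖_∞, m_α(f)}`, with values in `[0, ∞]`. -/
def circleHolderNorm (α : ℝ) (f : UnitCircle → ℂ) : ℝ≥0∞ :=
  max (⨆ x : UnitCircle, ‖f x‖ₑ) (holderSeminorm α f)

/-- The Hölder space `C_α(S¹)`: continuous functions with finite Hölder norm. -/
def HolderSpace (α : ℝ) : Set (UnitCircle → ℂ) :=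
  {f | Continuous f ∧ circleHolderNorm α f < ∞}

/-- The rotation matrix `R_η`. -/
def rotMatrix (η : ℝ) : Matrix (Fin 2) (Fin 2) ℝ :=
  !![Real.cos η, -Real.sin η; Real.sin η, Real.cos η]

/-- The vector `v = (1, -i) / √2`. -/
def vVec : Fin 2 → ℂ := ![1 / (Real.sqrt 2 : ℂ), -I / (Real.sqrt 2 : ℂ)]

section Family

variable {S : Type*}

/-- `λ = 0` is a critical point of the family `T`: the matrices at `λ = 0` commute and their traces
have modulus less than `2`. -/
def IsCriticalPoint (T : ℝ → S → SL2R) : Prop :=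
  (∀ s s' : S, T 0 s * T 0 s' = T 0 s' * T 0 s) ∧
    ∀ s : S, |(T 0 s : Matrix (Fin 2) (Fin 2) ℝ).trace| < 2

/-- The family `M T_{λ,σ} M⁻¹`. -/
def conjFamily (M : SL2R) (T : ℝ → S → SL2R) (l : ℝ) (s : S) : SL2R := M * T l s * M⁻¹

/-- The first order coefficient `P_σ` of the normal form
`M T_{λ,σ} M⁻¹ = R_{η_σ} exp(λ P_σ + λ² Q_σ + O(λ³))`, that is, the derivative at `λ = 0` of
`R_{η_σ}⁻¹ M T_{λ,σ} M⁻¹`, where `R_{η_σ} = M T_{0,σ} M⁻¹`. -/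
def firstOrderCoeff (M : SL2R) (T : ℝ → S → SL2R) (s : S) : Matrix (Fin 2) (Fin 2) ℝ :=
  Matrix.of fun i j => deriv (fun l : ℝ =>
    (((conjFamily M T 0 s)⁻¹ * conjFamily M T l s : SL2R) : Matrix (Fin 2) (Fin 2) ℝ) i j) 0

/-- `β_σ = ⟨v̄ | P_σ | v⟩`, with the scalar product antilinear in its first entry. -/
def betaCoeff (M : SL2R) (T : ℝ → S → SL2R) (s : S) : ℂ :=
  star (star vVec) ⬝ᵥ ((firstOrderCoeff M T s).map (fun a : ℝ => (a : ℂ)) *ᵥ vVec)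

variable [MeasurableSpace S]

/-- The coefficient
`D = ½ E|β_σ|² + Re (E(β_σ) E(conj(β_σ) e^{2iη_σ}) / (1 - E(e^{2iη_σ})))`. -/
def coeffD (p : Measure S) (M : SL2R) (T : ℝ → S → SL2R) (η : S → ℝ) : ℝ :=
  1 / 2 * (∫ s, ‖betaCoeff M T s‖ ^ 2 ∂p) +
    (((∫ s, betaCoeff M T s ∂p) *
        (∫ s, (starRingEnd ℂ) (betaCoeff M T s) * cexp (2 * I * (η s : ℂ)) ∂p)) /
      (1 - ∫ s, cexp (2 * I * (η s : ℂ)) ∂p)).re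

/-- Regularity of the random family in the coupling parameter: it is measurable in the random
parameter and smooth in `λ`, and near `λ = 0` its entries and their `λ`-derivatives up to order
three are bounded by a random variable having a fifth moment. -/
structure IsRegularFamily (p : Measure S) (T : ℝ → S → SL2R) : Prop where
  measurable : ∀ (l : ℝ) (i j : Fin 2),
    Measurable fun s => (T l s : Matrix (Fin 2) (Fin 2) ℝ) i j
  smooth : ∀ (s : S) (i j : Fin 2),
    ContDiff ℝ ((⊤ : ℕ∞) : WithTop ℕ∞) fun l : ℝ => (T l s : Matrix (Fin 2) (Fin 2) ℝ) i j
  moments : ∃ (K : S → ℝ) (r : ℝ), MemLp K 5 p ∧ 0 < r ∧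
    ∀ (s : S) (l : ℝ), |l| ≤ r → ∀ k ≤ 3, ∀ i j : Fin 2,
      |iteratedDeriv k (fun l' : ℝ => (T l' s : Matrix (Fin 2) (Fin 2) ℝ) i j) l| ≤ K s

/-- The transfer operator `(𝒮 f)(e) = E f(𝒮_σ(e))` of the random matrix `A`. -/
def transferOp (p : Measure S) (A : S → SL2R) (f : UnitCircle → ℂ) : UnitCircle → ℂ :=
  fun x => ∫ s, f (circleAct (A s) x) ∂p

/-- The operator `𝒫`, mapping `f` to the constant function with value `∫ f dν`. -/
def meanOp (ν : Measure UnitCircle) (f : UnitCircle → ℂ) : UnitCircle → ℂ :=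
  fun _ => ∫ y, f y ∂ν

/-- Invariance of a measure on `S¹` under the random dynamical system given by `A`. -/
def IsInvariantMeasure (p : Measure S) (A : S → SL2R) (ν : Measure UnitCircle) : Prop :=
  ∀ f : C(UnitCircle, ℝ), ∫ x, f x ∂ν = ∫ x, (∫ s, f (circleAct (A s) x) ∂p) ∂ν

end Family

/-- The random orbit `θ_n = 𝒮_{σ_n}(θ_{n-1})` with `θ_0 = x`, where `σ_n = ω (n - 1)`. -/
def randomOrbit {S : Type*} (A : S → SL2R) (x : UnitCircle) (ω : ℕ → S) : ℕ → UnitCircle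
  | 0 => x
  | n + 1 => circleAct (A (ω n)) (randomOrbit A x ω n)

end

/-!
In the complex coordinate `z = x₀ + i x₁`, a matrix of determinant one acts as `z ↦ U z + W z̄` with
`|U|² - |W|² = 1`, and `δ (A e) (A e') = δ e e' / (‖A e‖ ‖A e'‖)`. Hence the Hölder seminorm of the
transfer operator is controlled by moments of `‖A e‖^(-2α)`, and it suffices to show that
`log ‖A e‖` has a positive mean, of order `λ²`, after adding a coboundary.

Write `U = e^{iη} u`, `W = e^{iη} w`, `ζ = z²`, `ρ = e^{2iη}`. Then `w = O(λ)`, `u = 1 + O(λ)`,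
`‖A e‖ = |u ζ + w|`, and `ζ` moves to `ρ (u ζ + w) / (ū + w̄ ζ)`. Take `g (ζ) = Re (a₁ ζ + a₂ ζ²)` with
`a₁ = O(λ)`, `a₂ = O(λ²)`. Up to `O(λ³)`, the increment of `g` minus `log ‖A e‖` is a trigonometric
polynomial in `ζ` of degree two (`increment_le_driftTerm`). Since `E ρ ≠ 1` and `E ρ² ≠ 1`, the
coefficients can be chosen so that its mean does not depend on `ζ`
(`IsPerturbedRotation.integral_driftTerm`), and this mean is `-D λ² + o(λ²)` by dominated convergence
(`IsPerturbedRotation.tendsto_drift`); `w` itself, not its Taylor coefficients, enters the equations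
for `a₁` and `a₂`, so that no second derivative in `λ` is needed. With `α = λ` the second order term
of the exponential is `O(α² λ²) = O(λ⁴)`, which is dominated by the gain `2 α D λ² = 2 D λ³`
(`IsPerturbedRotation.exists_corrector`).

Consequently the transfer operator contracts the Hölder seminorm for the weighted distance
`δ (e, e')^α exp (α (g (e) + g (e')))` by `exp (-c λ³)` in each step (`norm_transferOp_sub_le`). The
weight differs from one by `O(α λ) = O(λ²)`, which gives the prefactor `1 + C λ²`, and after `κ / λ`
steps this prefactor is absorbed by halving the rate. The supremum norm of `𝒮^N f - ∫ f dν` is at most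
the Hölder seminorm of `𝒮^N f` because `δ ≤ 1` and `ν` is invariant
(`circleHolderNorm_iterate_sub_le`). The correlation bound is the resulting geometric series, as an
even differentiable function is Lipschitz for `δ` (`norm_sub_le_of_deriv_le`) and the expectation along
the orbit is an iterate of the transfer operator (`integral_randomOrbit`). Invariant measures exist
by the Krylov–Bogoliubov argument (`exists_isInvariantMeasure`).
-/

noncomputable section

/-! ### Pointwise estimates for the Möbius action near the identity -/

theorem Real.exp_le_one_add_add_sq_mul_exp_abs (y : ℝ) :
    Real.exp y ≤ 1 + y + y ^ 2 * Real.exp |y| := by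
  have h1 : Real.exp y - 1 ≤ y * Real.exp y := by
    have := Real.add_one_le_exp (-y)
    have h2 : (-y + 1) * Real.exp y ≤ Real.exp (-y) * Real.exp y :=
      mul_le_mul_of_nonneg_right this (Real.exp_pos y).le
    rw [← Real.exp_add] at h2
    simp at h2
    linarith
  rcases le_or_gt 0 y with hy | hy
  · rw [abs_of_nonneg hy]
    nlinarith
  · have h3 := Real.add_one_le_exp y
    have h4 : 1 ≤ Real.exp |y| := Real.one_le_exp (abs_nonneg y)
    nlinarith [sq_nonneg y]

theorem Real.sub_sq_sub_cube_le_log {y : ℝ} (hy : |y| ≤ 3 / 4) :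
    y - y ^ 2 / 2 - 4 * |y| ^ 3 ≤ Real.log (1 + y) := by
  have h := Real.abs_log_sub_add_sum_range_le (x := -y) (by rw [abs_neg]; linarith) 2
  simp only [Finset.sum_range_succ, Finset.sum_range_zero, abs_neg] at h
  have h2 : |y| ^ 3 / (1 - |y|) ≤ 4 * |y| ^ 3 := by
    rw [div_le_iff₀ (by linarith)]
    nlinarith [pow_nonneg (abs_nonneg y) 3]
  have h3 := (abs_le.1 h).1
  norm_num at h3 h2
  linarith

section Pointwise

variable {u w ζ : ℂ} {t : ℝ}

theorem norm_sq_mul_add (hdet : ‖u‖ ^ 2 = 1 + ‖w‖ ^ 2) (hζ : ‖ζ‖ = 1) :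
    ‖u * ζ + w‖ ^ 2 = 1 + 2 * (‖w‖ ^ 2 + (u * (starRingEnd ℂ) w * ζ).re) := by
  have hζ2 : ‖ζ‖ ^ 2 = 1 := by rw [hζ]; norm_num
  simp only [← Complex.normSq_eq_norm_sq, Complex.normSq_apply] at *
  simp only [add_re, mul_re, add_im, mul_im, conj_re, conj_im]
  linear_combination (u.re * u.re + u.im * u.im) * hζ2 + hdet

theorem inv_le_norm_mul_add (hdet : ‖u‖ ^ 2 = 1 + ‖w‖ ^ 2) (hζ : ‖ζ‖ = 1) (hw : ‖w‖ ≤ t)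
    (hu : ‖u - 1‖ ≤ t) : (1 + 2 * t)⁻¹ ≤ ‖u * ζ + w‖ := by
  have ht : 0 ≤ t := (norm_nonneg _).trans hw
  have h1 : ‖u‖ - ‖w‖ ≤ ‖u * ζ + w‖ := by
    have := norm_sub_le (u * ζ + w) w
    rw [add_sub_cancel_right, norm_mul, hζ, mul_one] at this
    linarith
  have h2 : ‖u‖ ≤ 1 + t := by
    have := norm_add_le (u - 1) 1
    simp at this
    linarith
  have h3 : (‖u‖ - ‖w‖) * (‖u‖ + ‖w‖) = 1 := by linear_combination hdet
  have h4 : 0 < ‖u‖ := by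
    by_contra h
    have : ‖u‖ = 0 := le_antisymm (not_lt.1 h) (norm_nonneg _)
    rw [this] at hdet
    nlinarith [sq_nonneg ‖w‖]
  have h5 : 0 < ‖u‖ + ‖w‖ := by linarith [norm_nonneg w]
  have h6 : ‖u‖ - ‖w‖ = (‖u‖ + ‖w‖)⁻¹ := eq_inv_of_mul_eq_one_left h3
  refine le_trans ?_ h1
  rw [h6]
  exact inv_anti₀ h5 (by linarith)

theorem abs_log_norm_le (hdet : ‖u‖ ^ 2 = 1 + ‖w‖ ^ 2) (hζ : ‖ζ‖ = 1) (hw : ‖w‖ ≤ t)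
    (hu : ‖u - 1‖ ≤ t) : |Real.log ‖u * ζ + w‖| ≤ Real.log (1 + 2 * t) := by
  have ht : 0 ≤ t := (norm_nonneg _).trans hw
  have h1 := inv_le_norm_mul_add hdet hζ hw hu
  have h0 : 0 < ‖u * ζ + w‖ := lt_of_lt_of_le (by positivity) h1
  have h2 : ‖u * ζ + w‖ ≤ 1 + 2 * t := by
    have h2 : ‖u‖ ≤ 1 + t := by
      have := norm_add_le (u - 1) 1
      simp at this
      linarith
    refine (norm_add_le _ _).trans ?_
    rw [norm_mul, hζ]
    linarith
  rw [abs_le]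
  constructor
  · rw [← Real.log_inv]
    exact Real.log_le_log (by positivity) h1
  · exact Real.log_le_log h0 h2

/-- Only a lower bound for the logarithm is expanded; for large `t` the cubic term takes over, so
that no smallness of the random variable `t` is needed. -/
theorem neg_log_norm_le (hdet : ‖u‖ ^ 2 = 1 + ‖w‖ ^ 2) (hζ : ‖ζ‖ = 1) (hw : ‖w‖ ≤ t)
    (hu : ‖u - 1‖ ≤ t) :
    -Real.log ‖u * ζ + w‖ ≤ -‖w‖ ^ 2 - (u * (starRingEnd ℂ) w * ζ).re
      + ((starRingEnd ℂ) w * ζ).re ^ 2 + 64 * t ^ 3 := by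
  have ht : 0 ≤ t := (norm_nonneg _).trans hw
  have hu1 : ‖u‖ ≤ 1 + t := by
    have := norm_add_le (u - 1) 1
    simp at this
    linarith
  set r := (u * (starRingEnd ℂ) w * ζ).re with hr
  set r0 := ((starRingEnd ℂ) w * ζ).re with hr0
  have hn := norm_sq_mul_add hdet hζ
  rw [← hr] at hn
  have hrb : |r| ≤ (1 + t) * t := by
    refine (Complex.abs_re_le_norm _).trans ?_
    rw [norm_mul, norm_mul, hζ, mul_one, RCLike.norm_conj]
    exact mul_le_mul hu1 hw (norm_nonneg _) (by linarith)
  have hr0b : |r0| ≤ t := by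
    refine (Complex.abs_re_le_norm _).trans ?_
    rw [norm_mul, hζ, mul_one, RCLike.norm_conj]
    exact hw
  have hdiff : |r - r0| ≤ t ^ 2 := by
    have : r - r0 = ((u - 1) * ((starRingEnd ℂ) w * ζ)).re := by
      rw [hr, hr0, ← Complex.sub_re]
      congr 1
      ring
    rw [this]
    refine (Complex.abs_re_le_norm _).trans ?_
    rw [norm_mul, norm_mul, hζ, mul_one, RCLike.norm_conj, sq]
    exact mul_le_mul hu hw (norm_nonneg _) ht
  have hw2 : ‖w‖ ^ 2 ≤ t ^ 2 := pow_le_pow_left₀ (norm_nonneg _) hw 2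
  have hw0 : 0 ≤ ‖w‖ ^ 2 := by positivity
  have hlog := abs_log_norm_le hdet hζ hw hu
  generalize ‖w‖ ^ 2 = W at *
  rcases le_or_gt t (1 / 4) with h | h
  · have hlog2 : Real.log ‖u * ζ + w‖ = Real.log (1 + 2 * (W + r)) / 2 := by
      rw [← hn, Real.log_pow]; push_cast; ring
    have hyb : |2 * (W + r)| ≤ 3 * t := by
      rw [abs_le] at hrb ⊢
      constructor <;> nlinarith
    have h3 := Real.sub_sq_sub_cube_le_log (hyb.trans (by linarith))
    have h4 : |2 * (W + r)| ^ 3 ≤ (3 * t) ^ 3 := pow_le_pow_left₀ (abs_nonneg _) hyb 3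
    have h5 : (W + r) ^ 2 ≤ r0 ^ 2 + 7 * t ^ 3 := by
      have e1 : |W + r - r0| ≤ 2 * t ^ 2 := by
        have : W + r - r0 = W + (r - r0) := by ring
        rw [this]
        refine (abs_add_le _ _).trans ?_
        rw [abs_of_nonneg hw0]
        linarith
      have e2 : |W + r + r0| ≤ 7 / 2 * t := by
        rw [abs_le] at hrb hr0b ⊢
        constructor <;> nlinarith
      have e3 : (W + r) ^ 2 - r0 ^ 2 ≤ |W + r - r0| * |W + r + r0| := by
        rw [← abs_mul]
        refine le_trans (le_of_eq ?_) (le_abs_self _)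
        ring
      have e4 : |W + r - r0| * |W + r + r0| ≤ 2 * t ^ 2 * (7 / 2 * t) :=
        mul_le_mul e1 e2 (abs_nonneg _) (by positivity)
      nlinarith
    rw [hlog2]
    nlinarith [pow_nonneg ht 3]
  · have h1 : Real.log (1 + 2 * t) ≤ 2 * t := by
      have := Real.log_le_sub_one_of_pos (show 0 < 1 + 2 * t by linarith)
      linarith
    have h2 := (abs_le.1 hlog).1
    have h3 := (abs_le.1 hrb).2
    have h4 : t ^ 2 ≤ 4 * t ^ 3 := by nlinarith [sq_nonneg t]
    have h5 : t ≤ 4 * t ^ 2 := by nlinarith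
    nlinarith [sq_nonneg r0]

/-- The Möbius transformation of the unit circle induced by `z ↦ u z + w z̄` through `ζ = z²`. -/
def moebius (u w ζ : ℂ) : ℂ := (u * ζ + w) / ((starRingEnd ℂ) u + (starRingEnd ℂ) w * ζ)

theorem norm_moebius_denom (hζ : ‖ζ‖ = 1) :
    ‖(starRingEnd ℂ) u + (starRingEnd ℂ) w * ζ‖ = ‖u * ζ + w‖ := by
  have hc : ζ * (starRingEnd ℂ) ζ = 1 := by
    rw [Complex.mul_conj, Complex.normSq_eq_norm_sq, hζ]; norm_num
  have : (starRingEnd ℂ) u + (starRingEnd ℂ) w * ζ = ζ * (starRingEnd ℂ) (u * ζ + w) := by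
    simp only [map_add, map_mul]
    linear_combination (-(starRingEnd ℂ) u) * hc
  rw [this, norm_mul, hζ, one_mul, RCLike.norm_conj]

theorem norm_mul_add_pos (hdet : ‖u‖ ^ 2 = 1 + ‖w‖ ^ 2) (hζ : ‖ζ‖ = 1) : 0 < ‖u * ζ + w‖ := by
  have h0 : 0 ≤ max ‖w‖ ‖u - 1‖ := (norm_nonneg w).trans (le_max_left _ _)
  have := inv_le_norm_mul_add hdet hζ (le_max_left ‖w‖ ‖u - 1‖) (le_max_right _ _)
  exact lt_of_lt_of_le (by positivity) this

theorem norm_moebius (hdet : ‖u‖ ^ 2 = 1 + ‖w‖ ^ 2) (hζ : ‖ζ‖ = 1) : ‖moebius u w ζ‖ = 1 := by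
  rw [moebius, norm_div, norm_moebius_denom hζ]
  exact div_self (norm_mul_add_pos hdet hζ).ne'

/-- First order expansion of the Möbius action near the identity. -/
theorem norm_moebius_sub_le (hdet : ‖u‖ ^ 2 = 1 + ‖w‖ ^ 2) (hζ : ‖ζ‖ = 1) (hw : ‖w‖ ≤ t)
    (hu : ‖u - 1‖ ≤ t) :
    ‖moebius u w ζ - (ζ + (u - (starRingEnd ℂ) u) * ζ + w - (starRingEnd ℂ) w * ζ ^ 2)‖
      ≤ 48 * t ^ 2 := by
  have ht : 0 ≤ t := (norm_nonneg _).trans hw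
  have hu' : ‖(starRingEnd ℂ) u - 1‖ ≤ t := by
    have : (starRingEnd ℂ) u - 1 = (starRingEnd ℂ) (u - 1) := by simp
    rw [this, RCLike.norm_conj]; exact hu
  have huu : ‖u - (starRingEnd ℂ) u‖ ≤ 2 * t := by
    have : u - (starRingEnd ℂ) u = (u - 1) - ((starRingEnd ℂ) u - 1) := by ring
    rw [this]
    exact (norm_sub_le _ _).trans (by linarith)
  set q := (u - (starRingEnd ℂ) u) * ζ + w - (starRingEnd ℂ) w * ζ ^ 2 with hq
  have hqb : ‖q‖ ≤ 4 * t := by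
    refine (norm_sub_le _ _).trans ?_
    rw [norm_mul, norm_pow, hζ, RCLike.norm_conj]
    have := norm_add_le ((u - (starRingEnd ℂ) u) * ζ) w
    rw [norm_mul, hζ] at this
    linarith
  have hrw : ζ + (u - (starRingEnd ℂ) u) * ζ + w - (starRingEnd ℂ) w * ζ ^ 2 = ζ + q := by
    rw [hq]; ring
  rw [hrw]
  rcases le_or_gt t (1 / 4) with h | h
  · have hpos := norm_mul_add_pos hdet hζ
    have hden : (starRingEnd ℂ) u + (starRingEnd ℂ) w * ζ ≠ 0 := by
      rw [← norm_pos_iff, norm_moebius_denom hζ]; exact hpos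
    have key : moebius u w ζ - (ζ + q) =
        -(((starRingEnd ℂ) u - 1 + (starRingEnd ℂ) w * ζ) * q) /
          ((starRingEnd ℂ) u + (starRingEnd ℂ) w * ζ) := by
      rw [moebius, eq_div_iff hden, sub_mul, div_mul_cancel₀ _ hden, hq]
      ring
    have h1 : ‖(starRingEnd ℂ) u - 1 + (starRingEnd ℂ) w * ζ‖ ≤ 2 * t := by
      refine (norm_add_le _ _).trans ?_
      rw [norm_mul, hζ, RCLike.norm_conj]
      linarith
    have h2 : 1 / 2 ≤ ‖(starRingEnd ℂ) u + (starRingEnd ℂ) w * ζ‖ := by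
      have e : (1 : ℂ) = ((starRingEnd ℂ) u + (starRingEnd ℂ) w * ζ) -
        ((starRingEnd ℂ) u - 1 + (starRingEnd ℂ) w * ζ) := by ring
      have := norm_sub_le ((starRingEnd ℂ) u + (starRingEnd ℂ) w * ζ)
        ((starRingEnd ℂ) u - 1 + (starRingEnd ℂ) w * ζ)
      rw [← e] at this
      simp at this
      linarith
    rw [key, norm_div, norm_neg, norm_mul, div_le_iff₀ (by linarith)]
    have h3 : ‖(starRingEnd ℂ) u - 1 + (starRingEnd ℂ) w * ζ‖ * ‖q‖ ≤ 2 * t * (4 * t) :=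
      mul_le_mul h1 hqb (norm_nonneg _) (by linarith)
    nlinarith [sq_nonneg t]
  · refine (norm_sub_le _ _).trans ?_
    rw [norm_moebius hdet hζ]
    have := norm_add_le ζ q
    rw [hζ] at this
    nlinarith

theorem norm_moebius_sub_self_le (hdet : ‖u‖ ^ 2 = 1 + ‖w‖ ^ 2) (hζ : ‖ζ‖ = 1) (hw : ‖w‖ ≤ t)
    (hu : ‖u - 1‖ ≤ t) : ‖moebius u w ζ - ζ‖ ≤ 16 * t := by
  have ht : 0 ≤ t := (norm_nonneg _).trans hw
  rcases le_or_gt t (1 / 4) with h | h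
  · have h1 := norm_moebius_sub_le hdet hζ hw hu
    have huu : ‖u - (starRingEnd ℂ) u‖ ≤ 2 * t := by
      have : u - (starRingEnd ℂ) u = (u - 1) - (starRingEnd ℂ) (u - 1) := by
        simp
      rw [this]
      refine (norm_sub_le _ _).trans ?_
      rw [RCLike.norm_conj]; linarith
    have hqb : ‖(u - (starRingEnd ℂ) u) * ζ + w - (starRingEnd ℂ) w * ζ ^ 2‖ ≤ 4 * t := by
      refine (norm_sub_le _ _).trans ?_
      rw [norm_mul, norm_pow, hζ, RCLike.norm_conj]
      have := norm_add_le ((u - (starRingEnd ℂ) u) * ζ) w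
      rw [norm_mul, hζ] at this
      linarith
    have e : moebius u w ζ - ζ =
      (moebius u w ζ - (ζ + (u - (starRingEnd ℂ) u) * ζ + w - (starRingEnd ℂ) w * ζ ^ 2)) +
      ((u - (starRingEnd ℂ) u) * ζ + w - (starRingEnd ℂ) w * ζ ^ 2) := by ring
    rw [e]
    refine (norm_add_le _ _).trans ?_
    nlinarith
  · refine (norm_sub_le _ _).trans ?_
    rw [norm_moebius hdet hζ, hζ]
    linarith

/-- The trigonometric polynomial `Re (a ζ + b ζ²)` on the unit circle. -/
def trigPoly (a b ζ : ℂ) : ℝ := (a * ζ + b * ζ ^ 2).re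

/-- The terms of order at most two of the increment of `trigPoly (c₁ + c₂) c₄` under
`ζ ↦ ρ (u ζ + w) / (ū + w̄ ζ)` minus `log |u ζ + w|`, where `c₁` has order one and `c₂`, `c₄` have order
two. -/
def driftTerm (u w ρ c₁ c₂ c₄ ζ : ℂ) : ℝ :=
  (c₁ * (ρ - 1) * ζ).re - (u * (starRingEnd ℂ) w * ζ).re + (c₂ * (ρ - 1) * ζ).re +
    (c₄ * (ρ ^ 2 - 1) * ζ ^ 2).re - ‖w‖ ^ 2 / 2 + (((starRingEnd ℂ) w) ^ 2 * ζ ^ 2).re / 2 +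
    (c₁ * (ρ * w)).re + (c₁ * (ρ * (u - (starRingEnd ℂ) u)) * ζ).re -
    (c₁ * (ρ * (starRingEnd ℂ) w) * ζ ^ 2).re

variable {ρ c₁ c₂ c₄ : ℂ} {l C₀ : ℝ}

theorem increment_le_driftTerm (hdet : ‖u‖ ^ 2 = 1 + ‖w‖ ^ 2) (hζ : ‖ζ‖ = 1) (hρ : ‖ρ‖ = 1)
    (hw : ‖w‖ ≤ t) (hu : ‖u - 1‖ ≤ t) (hl : 0 ≤ l) (hlt : l ≤ t) (hC : 0 ≤ C₀)
    (h1 : ‖c₁‖ ≤ C₀ * l) (h2 : ‖c₂‖ ≤ C₀ * l ^ 2) (h4 : ‖c₄‖ ≤ C₀ * l ^ 2) :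
    trigPoly (c₁ + c₂) c₄ (ρ * moebius u w ζ) - trigPoly (c₁ + c₂) c₄ ζ -
      Real.log ‖u * ζ + w‖ ≤ driftTerm u w ρ c₁ c₂ c₄ ζ + (64 + 96 * C₀) * t ^ 3 := by
  have ht : 0 ≤ t := (norm_nonneg _).trans hw
  have hlog := neg_log_norm_le hdet hζ hw hu
  have e1 := norm_moebius_sub_le hdet hζ hw hu
  have e2 := norm_moebius_sub_self_le hdet hζ hw hu
  have e3 : ‖moebius u w ζ ^ 2 - ζ ^ 2‖ ≤ 32 * t := by
    have : moebius u w ζ ^ 2 - ζ ^ 2 = (moebius u w ζ - ζ) * (moebius u w ζ + ζ) := by ring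
    rw [this, norm_mul]
    have h := norm_add_le (moebius u w ζ) ζ
    rw [norm_moebius hdet hζ, hζ] at h
    have := mul_le_mul e2 h (norm_nonneg _) (by positivity)
    linarith
  set m := moebius u w ζ with hm
  set q := ζ + (u - (starRingEnd ℂ) u) * ζ + w - (starRingEnd ℂ) w * ζ ^ 2 with hq
  have f1 : (c₁ * ρ * (m - q)).re ≤ 48 * C₀ * t ^ 3 := by
    refine (Complex.re_le_norm _).trans ?_
    rw [norm_mul, norm_mul, hρ, mul_one]
    calc ‖c₁‖ * ‖m - q‖ ≤ (C₀ * l) * (48 * t ^ 2) :=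
          mul_le_mul h1 e1 (norm_nonneg _) (by positivity)
      _ ≤ (C₀ * t) * (48 * t ^ 2) := by gcongr
      _ = _ := by ring
  have f2 : (c₂ * ρ * (m - ζ)).re ≤ 16 * C₀ * t ^ 3 := by
    refine (Complex.re_le_norm _).trans ?_
    rw [norm_mul, norm_mul, hρ, mul_one]
    calc ‖c₂‖ * ‖m - ζ‖ ≤ (C₀ * l ^ 2) * (16 * t) :=
          mul_le_mul h2 e2 (norm_nonneg _) (by positivity)
      _ ≤ (C₀ * t ^ 2) * (16 * t) := by gcongr
      _ = _ := by ring
  have f4 : (c₄ * ρ ^ 2 * (m ^ 2 - ζ ^ 2)).re ≤ 32 * C₀ * t ^ 3 := by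
    refine (Complex.re_le_norm _).trans ?_
    rw [norm_mul, norm_mul, norm_pow, hρ, one_pow, mul_one]
    calc ‖c₄‖ * ‖m ^ 2 - ζ ^ 2‖ ≤ (C₀ * l ^ 2) * (32 * t) :=
          mul_le_mul h4 e3 (norm_nonneg _) (by positivity)
      _ ≤ (C₀ * t ^ 2) * (32 * t) := by gcongr
      _ = _ := by ring
  -- `(Re q)² = (|q|² + Re q²) / 2` splits the square into its mean and an oscillating part
  have hsq : ((starRingEnd ℂ) w * ζ).re ^ 2 =
      ‖w‖ ^ 2 / 2 + (((starRingEnd ℂ) w) ^ 2 * ζ ^ 2).re / 2 := by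
    have hz : ∀ z : ℂ, z.re ^ 2 = ‖z‖ ^ 2 / 2 + (z ^ 2).re / 2 := by
      intro z
      rw [← Complex.normSq_eq_norm_sq, Complex.normSq_apply, sq z, mul_re]
      ring
    rw [hz, norm_mul, hζ, RCLike.norm_conj, mul_one, mul_pow]
  have key : trigPoly (c₁ + c₂) c₄ (ρ * m) - trigPoly (c₁ + c₂) c₄ ζ =
      (c₁ * ρ * (m - q)).re + (c₂ * ρ * (m - ζ)).re + (c₄ * ρ ^ 2 * (m ^ 2 - ζ ^ 2)).re +
      ((c₁ * (ρ - 1) * ζ).re + (c₂ * (ρ - 1) * ζ).re + (c₄ * (ρ ^ 2 - 1) * ζ ^ 2).re +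
        (c₁ * (ρ * w)).re + (c₁ * (ρ * (u - (starRingEnd ℂ) u)) * ζ).re -
        (c₁ * (ρ * (starRingEnd ℂ) w) * ζ ^ 2).re) := by
    rw [trigPoly, trigPoly]
    simp only [← Complex.add_re, ← Complex.sub_re]
    congr 1
    rw [hq]
    ring
  rw [key, driftTerm]
  rw [hsq] at hlog
  linarith

theorem abs_increment_le (hdet : ‖u‖ ^ 2 = 1 + ‖w‖ ^ 2) (hζ : ‖ζ‖ = 1) (hρ : ‖ρ‖ = 1)
    (hw : ‖w‖ ≤ t) (hu : ‖u - 1‖ ≤ t) (hl : 0 ≤ l) (hl1 : l ≤ 1) (hC : 0 ≤ C₀)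
    (h1 : ‖c₁‖ ≤ C₀ * l) (h2 : ‖c₂‖ ≤ C₀ * l ^ 2) (h4 : ‖c₄‖ ≤ C₀ * l ^ 2) :
    |trigPoly (c₁ + c₂) c₄ (ρ * moebius u w ζ) - trigPoly (c₁ + c₂) c₄ ζ -
      Real.log ‖u * ζ + w‖| ≤ 6 * C₀ * l + Real.log (1 + 2 * t) := by
  have hlog := abs_log_norm_le hdet hζ hw hu
  have hl2 : C₀ * l ^ 2 ≤ C₀ * l := by
    apply mul_le_mul_of_nonneg_left _ hC
    nlinarith
  have hg : ∀ z : ℂ, ‖z‖ = 1 → |trigPoly (c₁ + c₂) c₄ z| ≤ 3 * C₀ * l := by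
    intro z hz
    refine (Complex.abs_re_le_norm _).trans ((norm_add_le _ _).trans ?_)
    rw [norm_mul, norm_mul, norm_pow, hz]
    have := norm_add_le c₁ c₂
    linarith
  have hm : ‖ρ * moebius u w ζ‖ = 1 := by rw [norm_mul, hρ, norm_moebius hdet hζ, mul_one]
  have g1 := abs_le.1 (hg _ hm)
  have g2 := abs_le.1 (hg _ hζ)
  have g3 := abs_le.1 hlog
  rw [abs_le]
  constructor <;> linarith [g1.1, g1.2, g2.1, g2.2, g3.1, g3.2]

/-- The pointwise bound on which the contraction rests: the exponential of a small multiple of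
the increment is at most its second order expansion with the increment replaced by its drift. -/
theorem exp_increment_le (hdet : ‖u‖ ^ 2 = 1 + ‖w‖ ^ 2) (hζ : ‖ζ‖ = 1) (hρ : ‖ρ‖ = 1)
    (hw : ‖w‖ ≤ t) (hu : ‖u - 1‖ ≤ t) (hl : 0 ≤ l) (hl1 : l ≤ 1) (hlt : l ≤ t) (hC : 0 ≤ C₀)
    (h1 : ‖c₁‖ ≤ C₀ * l) (h2 : ‖c₂‖ ≤ C₀ * l ^ 2) (h4 : ‖c₄‖ ≤ C₀ * l ^ 2)
    {α : ℝ} (hα : 0 ≤ α) (hα1 : α ≤ 1 / 2) :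
    Real.exp (2 * α * (trigPoly (c₁ + c₂) c₄ (ρ * moebius u w ζ) - trigPoly (c₁ + c₂) c₄ ζ -
      Real.log ‖u * ζ + w‖)) ≤ 1 + 2 * α * driftTerm u w ρ c₁ c₂ c₄ ζ +
        α * (2 * (64 + 96 * C₀)) * t ^ 3 +
        α ^ 2 * (4 * (6 * C₀ + 2) ^ 2 * Real.exp (6 * C₀)) * (t ^ 2 * (1 + 2 * t)) := by
  have ht : 0 ≤ t := (norm_nonneg _).trans hw
  have hX1 := increment_le_driftTerm hdet hζ hρ hw hu hl hlt hC h1 h2 h4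
  have hX2 := abs_increment_le hdet hζ hρ hw hu hl hl1 hC h1 h2 h4
  set X := trigPoly (c₁ + c₂) c₄ (ρ * moebius u w ζ) - trigPoly (c₁ + c₂) c₄ ζ -
      Real.log ‖u * ζ + w‖ with hX
  have hlog : Real.log (1 + 2 * t) ≤ 2 * t := by
    have := Real.log_le_sub_one_of_pos (show 0 < 1 + 2 * t by linarith)
    linarith
  have hX3 : |X| ≤ (6 * C₀ + 2) * t := by nlinarith
  have hX4 : Real.exp |2 * α * X| ≤ Real.exp (6 * C₀) * (1 + 2 * t) := by
    rw [← Real.exp_log (show 0 < 1 + 2 * t by linarith), ← Real.exp_add]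
    apply Real.exp_le_exp.2
    rw [abs_mul, abs_of_nonneg (by linarith : 0 ≤ 2 * α)]
    have : 2 * α * |X| ≤ 1 * |X| := mul_le_mul_of_nonneg_right (by linarith) (abs_nonneg _)
    nlinarith
  have hX5 : (2 * α * X) ^ 2 ≤ 4 * α ^ 2 * ((6 * C₀ + 2) * t) ^ 2 := by
    rw [mul_pow, mul_pow, ← sq_abs X]
    have := pow_le_pow_left₀ (abs_nonneg X) hX3 2
    nlinarith [sq_nonneg α]
  have h6 := Real.exp_le_one_add_add_sq_mul_exp_abs (2 * α * X)
  have h7 : (2 * α * X) ^ 2 * Real.exp |2 * α * X| ≤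
      4 * α ^ 2 * ((6 * C₀ + 2) * t) ^ 2 * (Real.exp (6 * C₀) * (1 + 2 * t)) :=
    mul_le_mul hX5 hX4 (Real.exp_pos _).le (by positivity)
  have h8 : 2 * α * X ≤ 2 * α * (driftTerm u w ρ c₁ c₂ c₄ ζ + (64 + 96 * C₀) * t ^ 3) :=
    mul_le_mul_of_nonneg_left hX1 (by linarith)
  nlinarith

end Pointwise

/-! ### The mean drift and the corrector -/

open Filter Topology in
/-- A random family of Möbius transformations `z ↦ u z + w z̄`, followed by a rotation with square
`ρ`, that is close to the identity for small `l`: the deviation is at most `l k` with a random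
`k` having a third moment, and `b` is the first order coefficient of `w`. -/
structure IsPerturbedRotation {S : Type*} [MeasurableSpace S] (p : Measure S)
    (u w : ℝ → S → ℂ) (ρ b : S → ℂ) (k : S → ℝ) (r : ℝ) : Prop where
  r_pos : 0 < r
  measurable_u : ∀ l, Measurable (u l)
  measurable_w : ∀ l, Measurable (w l)
  measurable_rho : Measurable ρ
  one_le : ∀ s, 1 ≤ k s
  integrable_cube : Integrable (fun s => k s ^ 3) p
  det : ∀ l s, ‖u l s‖ ^ 2 = 1 + ‖w l s‖ ^ 2
  norm_rho : ∀ s, ‖ρ s‖ = 1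
  norm_w_le : ∀ l s, 0 < l → l ≤ r → ‖w l s‖ ≤ l * k s
  norm_u_le : ∀ l s, 0 < l → l ≤ r → ‖u l s - 1‖ ≤ l * k s
  tendsto : ∀ s, Tendsto (fun l : ℝ => w l s / (l : ℂ)) (𝓝[>] 0) (𝓝 (b s))

namespace IsPerturbedRotation

variable {S : Type*} [MeasurableSpace S] {p : Measure S} {u w : ℝ → S → ℂ} {ρ b : S → ℂ} {k : S → ℝ} {r : ℝ}

theorem le_cube (h : IsPerturbedRotation p u w ρ b k r) (s : S) : k s ≤ k s ^ 3 := by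
  have := h.one_le s
  nlinarith [sq_nonneg (k s)]

theorem sq_le_cube (h : IsPerturbedRotation p u w ρ b k r) (s : S) : k s ^ 2 ≤ k s ^ 3 := by
  have := h.one_le s
  nlinarith [sq_nonneg (k s)]

theorem integrable_of_le (h : IsPerturbedRotation p u w ρ b k r) {f : S → ℂ} (hf : Measurable f)
    {C : ℝ} (hb : ∀ s, ‖f s‖ ≤ C * k s ^ 3) : Integrable f p :=
  (h.integrable_cube.const_mul C).mono' hf.aestronglyMeasurable (Filter.Eventually.of_forall hb)

theorem norm_integral_le_of_le (h : IsPerturbedRotation p u w ρ b k r) {f : S → ℂ}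
    {C : ℝ} (hb : ∀ s, ‖f s‖ ≤ C * k s ^ 3) : ‖∫ s, f s ∂p‖ ≤ C * ∫ s, k s ^ 3 ∂p := by
  rw [← integral_const_mul]
  exact norm_integral_le_of_norm_le (h.integrable_cube.const_mul C)
    (Filter.Eventually.of_forall hb)

variable {l : ℝ}

theorem norm_u_le' (h : IsPerturbedRotation p u w ρ b k r) (hl : 0 < l) (hlr : l ≤ r)
    (s : S) : ‖u l s‖ ≤ 1 + l * k s := by
  have := norm_add_le (u l s - 1) 1
  simp at this
  linarith [h.norm_u_le l s hl hlr]

theorem norm_mul_conj_le (h : IsPerturbedRotation p u w ρ b k r) (hl : 0 < l) (hlr : l ≤ r)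
    (hl1 : l ≤ 1) (s : S) : ‖u l s * (starRingEnd ℂ) (w l s)‖ ≤ 2 * l * k s ^ 3 := by
  rw [norm_mul, RCLike.norm_conj]
  have h1 := h.norm_u_le' hl hlr s
  have h2 := h.norm_w_le l s hl hlr
  have hk := h.one_le s
  have h3 : l * k s ≤ k s := by nlinarith
  calc ‖u l s‖ * ‖w l s‖ ≤ (1 + l * k s) * (l * k s) :=
        mul_le_mul h1 h2 (norm_nonneg _) (by positivity)
    _ ≤ (2 * k s) * (l * k s) := by
        apply mul_le_mul_of_nonneg_right _ (by positivity); linarith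
    _ = 2 * l * k s ^ 2 := by ring
    _ ≤ 2 * l * k s ^ 3 := by
        apply mul_le_mul_of_nonneg_left (h.sq_le_cube s) (by positivity)

theorem norm_w_le_cube (h : IsPerturbedRotation p u w ρ b k r) (hl : 0 < l) (hlr : l ≤ r)
    (s : S) : ‖w l s‖ ≤ l * k s ^ 3 :=
  (h.norm_w_le l s hl hlr).trans (mul_le_mul_of_nonneg_left (h.le_cube s) hl.le)

theorem norm_w_sq_le_cube (h : IsPerturbedRotation p u w ρ b k r) (hl : 0 < l) (hlr : l ≤ r)
    (s : S) : ‖w l s‖ ^ 2 ≤ l ^ 2 * k s ^ 3 := by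
  refine (pow_le_pow_left₀ (norm_nonneg _) (h.norm_w_le l s hl hlr) 2).trans ?_
  rw [mul_pow]
  exact mul_le_mul_of_nonneg_left (h.sq_le_cube s) (by positivity)

theorem norm_u_sub_conj_le (h : IsPerturbedRotation p u w ρ b k r) (hl : 0 < l) (hlr : l ≤ r)
    (s : S) : ‖u l s - (starRingEnd ℂ) (u l s)‖ ≤ 2 * l * k s ^ 3 := by
  have e : u l s - (starRingEnd ℂ) (u l s) = (u l s - 1) - (starRingEnd ℂ) (u l s - 1) := by
    simp
  rw [e]
  refine (norm_sub_le _ _).trans ?_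
  rw [RCLike.norm_conj]
  have h1 := h.norm_u_le l s hl hlr
  have := mul_le_mul_of_nonneg_left (h.le_cube s) hl.le
  linarith

/-- With the coefficients `c₁, c₂, c₄` solving the averaged cohomological equations, the mean drift
does not depend on the point of the circle. -/
theorem integral_driftTerm [IsProbabilityMeasure p] (h : IsPerturbedRotation p u w ρ b k r) (hl : 0 < l) (hlr : l ≤ r)
    (hl1 : l ≤ 1) {c₁ c₂ c₄ : ℂ}
    (h1 : c₁ * (∫ s, ρ s ∂p - 1) = ∫ s, u l s * (starRingEnd ℂ) (w l s) ∂p)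
    (h2 : c₂ * (∫ s, ρ s ∂p - 1) +
      c₁ * ∫ s, ρ s * (u l s - (starRingEnd ℂ) (u l s)) ∂p = 0)
    (h4 : c₄ * (∫ s, ρ s ^ 2 ∂p - 1) + (∫ s, (starRingEnd ℂ) (w l s) ^ 2 ∂p) / 2 -
      c₁ * ∫ s, ρ s * (starRingEnd ℂ) (w l s) ∂p = 0) (ζ : ℂ) :
    Integrable (fun s => driftTerm (u l s) (w l s) (ρ s) c₁ c₂ c₄ ζ) p ∧
    ∫ s, driftTerm (u l s) (w l s) (ρ s) c₁ c₂ c₄ ζ ∂p =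
      -(1 / 2 * (∫ s, ‖w l s‖ ^ 2 ∂p) - (c₁ * ∫ s, ρ s * w l s ∂p).re) := by
  have mu := h.measurable_u l
  have mw := h.measurable_w l
  have mρ := h.measurable_rho
  have mcu : Measurable fun s => (starRingEnd ℂ) (u l s) :=
    Complex.continuous_conj.measurable.comp mu
  have mcw : Measurable fun s => (starRingEnd ℂ) (w l s) :=
    Complex.continuous_conj.measurable.comp mw
  have i1 : Integrable (fun s => u l s * (starRingEnd ℂ) (w l s)) p :=
    h.integrable_of_le (mu.mul mcw) (h.norm_mul_conj_le hl hlr hl1)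
  have iρ : Integrable ρ p := by
    refine h.integrable_of_le (C := 1) mρ fun s => ?_
    rw [h.norm_rho, one_mul]
    exact one_le_pow₀ (h.one_le s)
  have iρ2 : Integrable (fun s => ρ s ^ 2) p := by
    refine h.integrable_of_le (C := 1) (mρ.pow_const 2) fun s => ?_
    rw [norm_pow, h.norm_rho, one_mul, one_pow]
    exact one_le_pow₀ (h.one_le s)
  have iuu : Integrable (fun s => ρ s * (u l s - (starRingEnd ℂ) (u l s))) p := by
    refine h.integrable_of_le (C := 2 * l) (mρ.mul (mu.sub mcu)) fun s => ?_
    rw [norm_mul, h.norm_rho, one_mul]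
    exact h.norm_u_sub_conj_le hl hlr s
  have iw2 : Integrable (fun s => (starRingEnd ℂ) (w l s) ^ 2) p := by
    refine h.integrable_of_le (C := l ^ 2) (mcw.pow_const 2) fun s => ?_
    rw [norm_pow, RCLike.norm_conj]
    exact h.norm_w_sq_le_cube hl hlr s
  have iw : Integrable (fun s => ρ s * w l s) p := by
    refine h.integrable_of_le (C := l) (mρ.mul mw) fun s => ?_
    rw [norm_mul, h.norm_rho, one_mul]
    exact h.norm_w_le_cube hl hlr s
  have icw : Integrable (fun s => ρ s * (starRingEnd ℂ) (w l s)) p := by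
    refine h.integrable_of_le (C := l) (mρ.mul mcw) fun s => ?_
    rw [norm_mul, h.norm_rho, one_mul, RCLike.norm_conj]
    exact h.norm_w_le_cube hl hlr s
  have inw : Integrable (fun s => ‖w l s‖ ^ 2) p := by
    refine (iw2.norm).congr (Filter.Eventually.of_forall fun s => ?_)
    simp [norm_pow]
  set F : S → ℂ := fun s =>
    ((c₁ * ζ) * (ρ s - 1) - (u l s * (starRingEnd ℂ) (w l s)) * ζ + (c₂ * ζ) * (ρ s - 1) +
    (c₄ * ζ ^ 2) * (ρ s ^ 2 - 1) + ((starRingEnd ℂ) (w l s) ^ 2) * (ζ ^ 2 / 2) +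
    c₁ * (ρ s * w l s) + (c₁ * ζ) * (ρ s * (u l s - (starRingEnd ℂ) (u l s))) -
    (c₁ * ζ ^ 2) * (ρ s * (starRingEnd ℂ) (w l s))) with hF
  have jF1 : Integrable (fun s => (c₁ * ζ) * (ρ s - 1)) p :=
    (iρ.sub (integrable_const 1)).const_mul _
  have jF2 := i1.mul_const ζ
  have jF3 : Integrable (fun s => (c₂ * ζ) * (ρ s - 1)) p :=
    (iρ.sub (integrable_const 1)).const_mul _
  have jF4 : Integrable (fun s => (c₄ * ζ ^ 2) * (ρ s ^ 2 - 1)) p :=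
    (iρ2.sub (integrable_const 1)).const_mul _
  have jF5 := iw2.mul_const (ζ ^ 2 / 2)
  have jF6 := iw.const_mul c₁
  have jF7 := iuu.const_mul (c₁ * ζ)
  have jF8 := icw.const_mul (c₁ * ζ ^ 2)
  have k2 := jF1.sub jF2
  have k3 := k2.add jF3
  have k4 := k3.add jF4
  have k5 := k4.add jF5
  have k6 := k5.add jF6
  have k7 := k6.add jF7
  have jF : Integrable F p := k7.sub jF8
  have hdr : ∀ s, driftTerm (u l s) (w l s) (ρ s) c₁ c₂ c₄ ζ = (F s).re - ‖w l s‖ ^ 2 / 2 := by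
    intro s
    have e : (((starRingEnd ℂ) (w l s) ^ 2) * (ζ ^ 2 / 2)).re =
        (((starRingEnd ℂ) (w l s)) ^ 2 * ζ ^ 2).re / 2 := by
      rw [← mul_div_assoc]
      exact Complex.div_ofNat_re _ 2
    rw [driftTerm, hF]
    simp only [Complex.add_re, Complex.sub_re, e]
    have e1 : c₁ * ζ * (ρ s - 1) = c₁ * (ρ s - 1) * ζ := by ring
    have e2 : c₂ * ζ * (ρ s - 1) = c₂ * (ρ s - 1) * ζ := by ring
    have e3 : c₄ * ζ ^ 2 * (ρ s ^ 2 - 1) = c₄ * (ρ s ^ 2 - 1) * ζ ^ 2 := by ring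
    have e4 : c₁ * ζ * (ρ s * (u l s - (starRingEnd ℂ) (u l s))) =
      c₁ * (ρ s * (u l s - (starRingEnd ℂ) (u l s))) * ζ := by ring
    have e5 : c₁ * ζ ^ 2 * (ρ s * (starRingEnd ℂ) (w l s)) =
      c₁ * (ρ s * (starRingEnd ℂ) (w l s)) * ζ ^ 2 := by ring
    rw [e1, e2, e3, e4, e5]
    ring
  have hFint : ∫ s, F s ∂p = c₁ * ∫ s, ρ s * w l s ∂p := by
    have s8 : ∫ s, F s ∂p = (∫ s, (c₁ * ζ) * (ρ s - 1) ∂p) -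
        (∫ s, (u l s * (starRingEnd ℂ) (w l s)) * ζ ∂p) + (∫ s, (c₂ * ζ) * (ρ s - 1) ∂p) +
        (∫ s, (c₄ * ζ ^ 2) * (ρ s ^ 2 - 1) ∂p) +
        (∫ s, ((starRingEnd ℂ) (w l s) ^ 2) * (ζ ^ 2 / 2) ∂p) +
        (∫ s, c₁ * (ρ s * w l s) ∂p) +
        (∫ s, (c₁ * ζ) * (ρ s * (u l s - (starRingEnd ℂ) (u l s))) ∂p) -
        (∫ s, (c₁ * ζ ^ 2) * (ρ s * (starRingEnd ℂ) (w l s)) ∂p) := by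
      rw [← integral_sub' jF1 jF2, ← integral_add' k2 jF3, ← integral_add' k3 jF4,
        ← integral_add' k4 jF5, ← integral_add' k5 jF6, ← integral_add' k6 jF7,
        ← integral_sub' k7 jF8]
      rfl
    rw [s8]
    simp only [integral_const_mul, integral_mul_const]
    rw [integral_sub iρ (integrable_const 1), integral_sub iρ2 (integrable_const 1)]
    simp only [integral_const, probReal_univ, one_smul]
    linear_combination ζ * h1 + ζ * h2 + ζ ^ 2 * h4
  simp only [hdr]
  refine ⟨jF.re.sub (inw.div_const 2), ?_⟩
  have ire : ∫ s, (F s).re ∂p = (∫ s, F s ∂p).re := integral_re jF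
  refine (integral_sub jF.re (inw.div_const 2)).trans ?_
  change ∫ s, (F s).re ∂p - _ = _
  rw [ire, hFint, integral_div]
  ring

open Filter Topology in
/-- The mean drift is `-D l² + o(l²)`. -/
theorem tendsto_drift (h : IsPerturbedRotation p u w ρ b k r) :
    Tendsto (fun l : ℝ => (1 / 2 * (∫ s, ‖w l s‖ ^ 2 ∂p) +
        ((∫ s, u l s * (starRingEnd ℂ) (w l s) ∂p) * (∫ s, ρ s * w l s ∂p) /
          (1 - ∫ s, ρ s ∂p)).re) / l ^ 2) (𝓝[>] 0)
      (𝓝 (1 / 2 * (∫ s, ‖b s‖ ^ 2 ∂p) +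
        ((∫ s, (starRingEnd ℂ) (b s) ∂p) * (∫ s, ρ s * b s ∂p) /
          (1 - ∫ s, ρ s ∂p)).re)) := by
  have hev : ∀ᶠ l : ℝ in 𝓝[>] 0, 0 < l ∧ l ≤ r ∧ l ≤ 1 := by
    have := Ioc_mem_nhdsGT (lt_min h.r_pos one_pos)
    filter_upwards [this] with l hl
    exact ⟨hl.1, hl.2.trans (min_le_left _ _), hl.2.trans (min_le_right _ _)⟩
  have hid : Tendsto (fun l : ℝ => l) (𝓝[>] 0) (𝓝 0) := tendsto_nhdsWithin_of_tendsto_nhds tendsto_id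
  have mcw : ∀ l, Measurable fun s => (starRingEnd ℂ) (w l s) := fun l =>
    Complex.continuous_conj.measurable.comp (h.measurable_w l)
  have t1 : Tendsto (fun l : ℝ => ∫ s, ‖w l s / (l : ℂ)‖ ^ 2 ∂p) (𝓝[>] 0)
      (𝓝 (∫ s, ‖b s‖ ^ 2 ∂p)) := by
    refine tendsto_integral_filter_of_dominated_convergence (fun s => k s ^ 3) ?_ ?_
      h.integrable_cube ?_
    · exact Eventually.of_forall fun l =>
        (((h.measurable_w l).div_const _).norm.pow_const 2).aestronglyMeasurable
    · filter_upwards [hev] with l hl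
      refine Eventually.of_forall fun s => ?_
      have h2 := h.norm_w_sq_le_cube hl.1 hl.2.1 s
      rw [norm_pow, norm_norm, norm_div, div_pow, Complex.norm_real, Real.norm_eq_abs, sq_abs,
        div_le_iff₀ (pow_pos hl.1 2)]
      linarith
    · exact Eventually.of_forall fun s => (h.tendsto s).norm.pow 2
  have t2 : Tendsto (fun l : ℝ => ∫ s, ρ s * (w l s / (l : ℂ)) ∂p) (𝓝[>] 0)
      (𝓝 (∫ s, ρ s * b s ∂p)) := by
    refine tendsto_integral_filter_of_dominated_convergence (fun s => k s ^ 3) ?_ ?_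
      h.integrable_cube ?_
    · exact Eventually.of_forall fun l =>
        (h.measurable_rho.mul ((h.measurable_w l).div_const _)).aestronglyMeasurable
    · filter_upwards [hev] with l hl
      refine Eventually.of_forall fun s => ?_
      have h2 := h.norm_w_le_cube hl.1 hl.2.1 s
      rw [norm_mul, h.norm_rho, one_mul, norm_div, Complex.norm_real, Real.norm_eq_abs,
        abs_of_pos hl.1, div_le_iff₀ hl.1]
      linarith
    · exact Eventually.of_forall fun s => (h.tendsto s).const_mul _
  have t3 : Tendsto (fun l : ℝ => ∫ s, u l s * (starRingEnd ℂ) (w l s) / (l : ℂ) ∂p) (𝓝[>] 0)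
      (𝓝 (∫ s, (starRingEnd ℂ) (b s) ∂p)) := by
    refine tendsto_integral_filter_of_dominated_convergence (fun s => 2 * k s ^ 3) ?_ ?_
      (h.integrable_cube.const_mul 2) ?_
    · exact Eventually.of_forall fun l =>
        (((h.measurable_u l).mul (mcw l)).div_const _).aestronglyMeasurable
    · filter_upwards [hev] with l hl
      refine Eventually.of_forall fun s => ?_
      have h2 := h.norm_mul_conj_le hl.1 hl.2.1 hl.2.2 s
      rw [norm_div, Complex.norm_real, Real.norm_eq_abs, abs_of_pos hl.1, div_le_iff₀ hl.1]
      linarith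
    · refine Eventually.of_forall fun s => ?_
      have hu : Tendsto (fun l : ℝ => u l s) (𝓝[>] 0) (𝓝 1) := by
        rw [tendsto_iff_norm_sub_tendsto_zero]
        refine squeeze_zero' (Eventually.of_forall fun _ => norm_nonneg _)
          (hev.mono fun l hl => h.norm_u_le l s hl.1 hl.2.1) ?_
        simpa using hid.mul_const (k s)
      have hw := (Complex.continuous_conj.tendsto (b s)).comp (h.tendsto s)
      have := hu.mul hw
      rw [one_mul] at this
      refine this.congr fun l => ?_
      simp only [Function.comp, map_div₀, Complex.conj_ofReal]
      ring
  have t4 := ((t1.const_mul (1 / 2)).add ((Complex.continuous_re.tendsto _).comp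
    ((t3.mul t2).div_const (1 - ∫ s, ρ s ∂p))))
  refine t4.congr' ?_
  filter_upwards [hev] with l hl
  have hl0 : (l : ℂ) ≠ 0 := by exact_mod_cast hl.1.ne'
  have e1 : ∫ s, ‖w l s / (l : ℂ)‖ ^ 2 ∂p = (∫ s, ‖w l s‖ ^ 2 ∂p) / l ^ 2 := by
    rw [← integral_div]
    congr 1
    ext s
    rw [norm_div, div_pow, Complex.norm_real, Real.norm_eq_abs, sq_abs]
  have e2 : ∫ s, ρ s * (w l s / (l : ℂ)) ∂p = (∫ s, ρ s * w l s ∂p) / l := by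
    rw [← integral_div]
    congr 1
    ext s
    ring
  have e3 : ((∫ s, u l s * (starRingEnd ℂ) (w l s) ∂p) / (l : ℂ) *
      ((∫ s, ρ s * w l s ∂p) / l) / (1 - ∫ s, ρ s ∂p)) =
      ((∫ s, u l s * (starRingEnd ℂ) (w l s) ∂p) * (∫ s, ρ s * w l s ∂p) /
          (1 - ∫ s, ρ s ∂p)) / ((l ^ 2 : ℝ) : ℂ) := by
    push_cast
    ring
  rw [Function.comp, integral_div, e1, e2, e3, Complex.div_ofReal_re]
  ring

/-- The averaged cohomological equations are solvable, with solutions of the expected size. -/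
theorem exists_coefficients [IsProbabilityMeasure p] (h : IsPerturbedRotation p u w ρ b k r)
    (hρ1 : ∫ s, ρ s ∂p ≠ 1) (hρ2 : ∫ s, ρ s ^ 2 ∂p ≠ 1) :
    ∃ C₀ : ℝ, 0 < C₀ ∧ ∀ l : ℝ, 0 < l → l ≤ r → l ≤ 1 → ∃ c₁ c₂ c₄ : ℂ,
      ‖c₁‖ ≤ C₀ * l ∧ ‖c₂‖ ≤ C₀ * l ^ 2 ∧ ‖c₄‖ ≤ C₀ * l ^ 2 ∧
      c₁ = -(∫ s, u l s * (starRingEnd ℂ) (w l s) ∂p) / (1 - ∫ s, ρ s ∂p) ∧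
      c₁ * (∫ s, ρ s ∂p - 1) = ∫ s, u l s * (starRingEnd ℂ) (w l s) ∂p ∧
      c₂ * (∫ s, ρ s ∂p - 1) + c₁ * ∫ s, ρ s * (u l s - (starRingEnd ℂ) (u l s)) ∂p = 0 ∧
      c₄ * (∫ s, ρ s ^ 2 ∂p - 1) + (∫ s, (starRingEnd ℂ) (w l s) ^ 2 ∂p) / 2 -
        c₁ * ∫ s, ρ s * (starRingEnd ℂ) (w l s) ∂p = 0 := by
  set m := ∫ s, k s ^ 3 ∂p with hm
  have hm1 : 1 ≤ m := by
    have := integral_mono (integrable_const (1 : ℝ)) h.integrable_cube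
      (fun s => one_le_pow₀ (h.one_le s))
    simpa using this
  have hq1 : 0 < ‖1 - ∫ s, ρ s ∂p‖ := norm_pos_iff.2 (sub_ne_zero.2 (Ne.symm hρ1))
  have hq2 : 0 < ‖1 - ∫ s, ρ s ^ 2 ∂p‖ := norm_pos_iff.2 (sub_ne_zero.2 (Ne.symm hρ2))
  set q := min ‖1 - ∫ s, ρ s ∂p‖ ‖1 - ∫ s, ρ s ^ 2 ∂p‖ with hq
  have hq0 : 0 < q := lt_min hq1 hq2
  set g := 2 * m / q with hg
  have hg0 : 0 < g := by positivity
  set C₀ := g + g ^ 2 with hC₀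
  have hC₀0 : 0 < C₀ := by positivity
  refine ⟨C₀, hC₀0, fun l hl hlr hl1 => ?_⟩
  set c₁ := -(∫ s, u l s * (starRingEnd ℂ) (w l s) ∂p) / (1 - ∫ s, ρ s ∂p) with hc₁
  set c₂ := (c₁ * ∫ s, ρ s * (u l s - (starRingEnd ℂ) (u l s)) ∂p) / (1 - ∫ s, ρ s ∂p) with hc₂
  set c₄ := ((∫ s, (starRingEnd ℂ) (w l s) ^ 2 ∂p) / 2 -
      c₁ * ∫ s, ρ s * (starRingEnd ℂ) (w l s) ∂p) / (1 - ∫ s, ρ s ^ 2 ∂p) with hc₄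
  have hne1 : 1 - ∫ s, ρ s ∂p ≠ 0 := norm_pos_iff.1 hq1
  have hne2 : 1 - ∫ s, ρ s ^ 2 ∂p ≠ 0 := norm_pos_iff.1 hq2
  have n1 : ‖c₁‖ ≤ g * l := by
    rw [hc₁, norm_div, norm_neg, div_le_iff₀ hq1]
    have e1 := h.norm_integral_le_of_le (h.norm_mul_conj_le hl hlr hl1)
    calc _ ≤ 2 * l * m := e1
      _ = g * l * q := by rw [hg]; field_simp
      _ ≤ _ := by apply mul_le_mul_of_nonneg_left (min_le_left _ _); positivity
  have n2 : ‖c₂‖ ≤ g ^ 2 * l ^ 2 := by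
    have e1 : ‖∫ s, ρ s * (u l s - (starRingEnd ℂ) (u l s)) ∂p‖ ≤ 2 * l * m := by
      refine h.norm_integral_le_of_le fun s => ?_
      rw [norm_mul, h.norm_rho, one_mul]
      exact h.norm_u_sub_conj_le hl hlr s
    rw [hc₂, norm_div, norm_mul, div_le_iff₀ hq1]
    calc _ ≤ (g * l) * (2 * l * m) := mul_le_mul n1 e1 (norm_nonneg _) (by positivity)
      _ = g ^ 2 * l ^ 2 * q := by rw [hg]; field_simp
      _ ≤ _ := by apply mul_le_mul_of_nonneg_left (min_le_left _ _); positivity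
  have n4 : ‖c₄‖ ≤ (g + g ^ 2) * l ^ 2 := by
    have e1 : ‖∫ s, (starRingEnd ℂ) (w l s) ^ 2 ∂p‖ ≤ l ^ 2 * m := by
      refine h.norm_integral_le_of_le fun s => ?_
      rw [norm_pow, RCLike.norm_conj]
      exact h.norm_w_sq_le_cube hl hlr s
    have e2 : ‖∫ s, ρ s * (starRingEnd ℂ) (w l s) ∂p‖ ≤ l * m := by
      refine h.norm_integral_le_of_le fun s => ?_
      rw [norm_mul, h.norm_rho, one_mul, RCLike.norm_conj]
      exact h.norm_w_le_cube hl hlr s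
    rw [hc₄, norm_div, div_le_iff₀ hq2]
    refine (norm_sub_le _ _).trans ?_
    rw [norm_div, norm_mul]
    have e3 : ‖c₁‖ * ‖∫ s, ρ s * (starRingEnd ℂ) (w l s) ∂p‖ ≤ (g * l) * (l * m) :=
      mul_le_mul n1 e2 (norm_nonneg _) (by positivity)
    have e4 : ‖(2 : ℂ)‖ = 2 := by norm_num
    rw [e4]
    calc _ ≤ l ^ 2 * m / 2 + (g * l) * (l * m) := by linarith
      _ ≤ 2 * (l ^ 2 * m) + 2 * ((g * l) * (l * m)) := by
          have : 0 ≤ l ^ 2 * m := by positivity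
          have : 0 ≤ (g * l) * (l * m) := by positivity
          linarith
      _ = (g + g ^ 2) * l ^ 2 * q := by rw [hg]; field_simp
      _ ≤ _ := by apply mul_le_mul_of_nonneg_left (min_le_right _ _); positivity
  have n1' : ‖c₁‖ ≤ C₀ * l := n1.trans (by rw [hC₀]; nlinarith [sq_nonneg g])
  have n2' : ‖c₂‖ ≤ C₀ * l ^ 2 := n2.trans (by rw [hC₀]; nlinarith [sq_nonneg l])
  have heq1 : c₁ * (∫ s, ρ s ∂p - 1) = ∫ s, u l s * (starRingEnd ℂ) (w l s) ∂p := by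
    rw [hc₁]; field_simp; ring
  have heq2 : c₂ * (∫ s, ρ s ∂p - 1) +
      c₁ * ∫ s, ρ s * (u l s - (starRingEnd ℂ) (u l s)) ∂p = 0 := by
    have : c₂ * (1 - ∫ s, ρ s ∂p) = c₁ * ∫ s, ρ s * (u l s - (starRingEnd ℂ) (u l s)) ∂p :=
      div_mul_cancel₀ _ hne1
    linear_combination -this
  have heq4 : c₄ * (∫ s, ρ s ^ 2 ∂p - 1) + (∫ s, (starRingEnd ℂ) (w l s) ^ 2 ∂p) / 2 -
      c₁ * ∫ s, ρ s * (starRingEnd ℂ) (w l s) ∂p = 0 := by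
    have : c₄ * (1 - ∫ s, ρ s ^ 2 ∂p) = (∫ s, (starRingEnd ℂ) (w l s) ^ 2 ∂p) / 2 -
      c₁ * ∫ s, ρ s * (starRingEnd ℂ) (w l s) ∂p := div_mul_cancel₀ _ hne2
    linear_combination -this
  exact ⟨c₁, c₂, c₄, n1', n2', n4, hc₁, heq1, heq2, heq4⟩

/-- The `2 l`-th moment of the corrected norm cocycle, when the mean drift is at most `-δ l²`. -/
theorem integral_exp_increment_le [IsProbabilityMeasure p] (h : IsPerturbedRotation p u w ρ b k r)
    {l C₀ δ : ℝ} (hl : 0 < l) (hlr : l ≤ r) (hl2 : l ≤ 1 / 2) (hC₀0 : 0 ≤ C₀) {c₁ c₂ c₄ ζ : ℂ}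
    (n1 : ‖c₁‖ ≤ C₀ * l) (n2 : ‖c₂‖ ≤ C₀ * l ^ 2) (n4 : ‖c₄‖ ≤ C₀ * l ^ 2) (hζ : ‖ζ‖ = 1)
    (iX : Integrable (fun s => driftTerm (u l s) (w l s) (ρ s) c₁ c₂ c₄ ζ) p)
    (eX : ∫ s, driftTerm (u l s) (w l s) (ρ s) c₁ c₂ c₄ ζ ∂p ≤ -(δ * l ^ 2)) :
    Integrable (fun s => Real.exp (2 * l * (trigPoly (c₁ + c₂) c₄
      (ρ s * moebius (u l s) (w l s) ζ) - trigPoly (c₁ + c₂) c₄ ζ -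
        Real.log ‖u l s * ζ + w l s‖))) p ∧
    ∫ s, Real.exp (2 * l * (trigPoly (c₁ + c₂) c₄
      (ρ s * moebius (u l s) (w l s) ζ) - trigPoly (c₁ + c₂) c₄ ζ -
        Real.log ‖u l s * ζ + w l s‖)) ∂p ≤ 1 - 2 * δ * l ^ 3 +
      l ^ 4 * (2 * (64 + 96 * C₀) + 3 * (4 * (6 * C₀ + 2) ^ 2 * Real.exp (6 * C₀))) *
        ∫ s, k s ^ 3 ∂p := by
  have hl1 : l ≤ 1 := by linarith
  set C₁ := 2 * (64 + 96 * C₀) with hC₁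
  set C₂ := 4 * (6 * C₀ + 2) ^ 2 * Real.exp (6 * C₀) with hC₂
  have hC₂0 : 0 ≤ C₂ := by positivity
  have hpt : ∀ s, Real.exp (2 * l * (trigPoly (c₁ + c₂) c₄
      (ρ s * moebius (u l s) (w l s) ζ) - trigPoly (c₁ + c₂) c₄ ζ -
        Real.log ‖u l s * ζ + w l s‖)) ≤
      1 + 2 * l * driftTerm (u l s) (w l s) (ρ s) c₁ c₂ c₄ ζ +
        l ^ 4 * (C₁ + 3 * C₂) * k s ^ 3 := by
    intro s
    have hk := h.one_le s
    have h1 := exp_increment_le (h.det l s) hζ (h.norm_rho s) (h.norm_w_le l s hl hlr)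
      (h.norm_u_le l s hl hlr) hl.le hl1 (by nlinarith) hC₀0 n1 n2 n4 hl.le hl2
    refine h1.trans ?_
    rw [← hC₁, ← hC₂]
    have h2 : (l * k s) ^ 2 * (1 + 2 * (l * k s)) ≤ 3 * l ^ 2 * k s ^ 3 := by
      have a1 := h.sq_le_cube s
      have a2 : 2 * l ^ 3 * k s ^ 3 ≤ 2 * l ^ 2 * k s ^ 3 := by
        apply mul_le_mul_of_nonneg_right _ (by positivity)
        nlinarith [sq_nonneg l]
      have a3 : l ^ 2 * k s ^ 2 ≤ l ^ 2 * k s ^ 3 :=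
        mul_le_mul_of_nonneg_left a1 (by positivity)
      linarith [show (l * k s) ^ 2 * (1 + 2 * (l * k s)) =
        l ^ 2 * k s ^ 2 + 2 * l ^ 3 * k s ^ 3 by ring]
    have h3 : l ^ 2 * C₂ * ((l * k s) ^ 2 * (1 + 2 * (l * k s))) ≤
        l ^ 2 * C₂ * (3 * l ^ 2 * k s ^ 3) := mul_le_mul_of_nonneg_left h2 (by positivity)
    linarith [show l * C₁ * (l * k s) ^ 3 + l ^ 2 * C₂ * (3 * l ^ 2 * k s ^ 3) =
      l ^ 4 * (C₁ + 3 * C₂) * k s ^ 3 by ring]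
  have iR : Integrable (fun s => 1 + 2 * l * driftTerm (u l s) (w l s) (ρ s) c₁ c₂ c₄ ζ +
        l ^ 4 * (C₁ + 3 * C₂) * k s ^ 3) p :=
    ((integrable_const 1).add (iX.const_mul (2 * l))).add (h.integrable_cube.const_mul _)
  have hmeas : Measurable fun s => Real.exp (2 * l * (trigPoly (c₁ + c₂) c₄
      (ρ s * moebius (u l s) (w l s) ζ) - trigPoly (c₁ + c₂) c₄ ζ -
        Real.log ‖u l s * ζ + w l s‖)) := by
    have mu := h.measurable_u l
    have mw := h.measurable_w l
    have mρ := h.measurable_rho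
    have mcu : Measurable fun s => (starRingEnd ℂ) (u l s) :=
      Complex.continuous_conj.measurable.comp mu
    have mcw : Measurable fun s => (starRingEnd ℂ) (w l s) :=
      Complex.continuous_conj.measurable.comp mw
    have mt : Continuous (trigPoly (c₁ + c₂) c₄) := by
      unfold trigPoly; fun_prop
    have mm : Measurable fun s => ρ s * moebius (u l s) (w l s) ζ := by
      unfold moebius; fun_prop
    have := mt.measurable.comp mm
    simp only [Function.comp_def] at this
    fun_prop
  have iL := iR.mono' hmeas.aestronglyMeasurable (Filter.Eventually.of_forall fun s => by
    rw [Real.norm_eq_abs, abs_of_pos (Real.exp_pos _)]; exact hpt s)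
  refine ⟨iL, (integral_mono iL iR hpt).trans ?_⟩
  refine (integral_add (f := fun s => 1 + 2 * l * driftTerm (u l s) (w l s) (ρ s) c₁ c₂ c₄ ζ)
    ((integrable_const 1).add (iX.const_mul (2 * l)))
    (h.integrable_cube.const_mul _)).trans_le ?_
  rw [integral_add (integrable_const 1) (iX.const_mul (2 * l)), integral_const_mul,
    integral_const_mul]
  simp only [integral_const, probReal_univ, one_smul]
  have := mul_le_mul_of_nonneg_left eX (show 0 ≤ 2 * l by linarith)
  linarith [show 2 * l * -(δ * l ^ 2) = -(2 * δ * l ^ 3) by ring]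

open Filter Topology in
/-- For small `l` there is a corrector, a trigonometric polynomial of size `O(l)`, for which the
corrected norm cocycle contracts in the `2 l`-th mean by a factor `exp (-c l³)`, uniformly on the
circle. -/
theorem exists_corrector [IsProbabilityMeasure p] (h : IsPerturbedRotation p u w ρ b k r)
    (hρ1 : ∫ s, ρ s ∂p ≠ 1) (hρ2 : ∫ s, ρ s ^ 2 ∂p ≠ 1)
    (hD : 0 < 1 / 2 * (∫ s, ‖b s‖ ^ 2 ∂p) +
        ((∫ s, (starRingEnd ℂ) (b s) ∂p) * (∫ s, ρ s * b s ∂p) /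
          (1 - ∫ s, ρ s ∂p)).re) :
    ∃ G c l₀ : ℝ, 0 < G ∧ 0 < c ∧ 0 < l₀ ∧ l₀ ≤ 1 / 2 ∧ ∀ l : ℝ, 0 < l → l ≤ l₀ →
      ∃ a₁ a₂ : ℂ, (∀ ζ : ℂ, ‖ζ‖ = 1 → |trigPoly a₁ a₂ ζ| ≤ G * l) ∧
        ∀ ζ : ℂ, ‖ζ‖ = 1 →
          Integrable (fun s => Real.exp (2 * l * (trigPoly a₁ a₂ (ρ s * moebius (u l s) (w l s) ζ) -
            trigPoly a₁ a₂ ζ - Real.log ‖u l s * ζ + w l s‖))) p ∧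
          ∫ s, Real.exp (2 * l * (trigPoly a₁ a₂ (ρ s * moebius (u l s) (w l s) ζ) -
            trigPoly a₁ a₂ ζ - Real.log ‖u l s * ζ + w l s‖)) ∂p ≤ Real.exp (-c * l ^ 3) := by
  set D := 1 / 2 * (∫ s, ‖b s‖ ^ 2 ∂p) +
        ((∫ s, (starRingEnd ℂ) (b s) ∂p) * (∫ s, ρ s * b s ∂p) /
          (1 - ∫ s, ρ s ∂p)).re with hDdef
  set m := ∫ s, k s ^ 3 ∂p with hm
  have hm1 : 1 ≤ m := by
    have := integral_mono (integrable_const (1 : ℝ)) h.integrable_cube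
      (fun s => one_le_pow₀ (h.one_le s))
    simpa using this
  obtain ⟨C₀, hC₀, hcoef⟩ := h.exists_coefficients hρ1 hρ2
  set E := 2 * (64 + 96 * C₀) + 3 * (4 * (6 * C₀ + 2) ^ 2 * Real.exp (6 * C₀)) with hE
  have hE0 : 0 < E := by positivity
  obtain ⟨l₁, hl₁, hdrift⟩ : ∃ l₁ : ℝ, 0 < l₁ ∧ ∀ l : ℝ, 0 < l → l ≤ l₁ → 3 / 4 * D * l ^ 2 ≤
      1 / 2 * (∫ s, ‖w l s‖ ^ 2 ∂p) +
        ((∫ s, u l s * (starRingEnd ℂ) (w l s) ∂p) * (∫ s, ρ s * w l s ∂p) /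
          (1 - ∫ s, ρ s ∂p)).re := by
    have h1 := h.tendsto_drift.eventually (lt_mem_nhds (show 3 / 4 * D < D by linarith))
    obtain ⟨l₁, hl₁, h2⟩ := mem_nhdsGT_iff_exists_Ioc_subset.1 h1
    refine ⟨l₁, hl₁, fun l hl hl' => ?_⟩
    have h3 := h2 ⟨hl, hl'⟩
    change 3 / 4 * D < _ at h3
    exact ((lt_div_iff₀ (pow_pos hl 2)).1 h3).le
  set l₀ := min (min (1 / 2) r) (min l₁ (D / (2 * E * m))) with hl₀
  have hl₀pos : 0 < l₀ := by
    refine lt_min (lt_min (by norm_num) h.r_pos) (lt_min hl₁ ?_)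
    positivity
  refine ⟨3 * C₀, D, l₀, by positivity, hD, hl₀pos,
    (min_le_left _ _).trans (min_le_left _ _), fun l hl hll => ?_⟩
  have hl2 : l ≤ 1 / 2 := hll.trans ((min_le_left _ _).trans (min_le_left _ _))
  have hl1 : l ≤ 1 := by linarith
  have hlr : l ≤ r := hll.trans ((min_le_left _ _).trans (min_le_right _ _))
  have hll1 : l ≤ l₁ := hll.trans ((min_le_right _ _).trans (min_le_left _ _))
  have hlD : l ≤ D / (2 * E * m) :=
    hll.trans ((min_le_right _ _).trans (min_le_right _ _))
  obtain ⟨c₁, c₂, c₄, n1, n2, n4, hc₁, heq1, heq2, heq4⟩ := hcoef l hl hlr hl1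
  refine ⟨c₁ + c₂, c₄, fun ζ hζ => ?_, fun ζ hζ => ?_⟩
  · refine (Complex.abs_re_le_norm _).trans ((norm_add_le _ _).trans ?_)
    rw [norm_mul, norm_mul, norm_pow, hζ]
    have := norm_add_le c₁ c₂
    have hh : C₀ * l ^ 2 ≤ C₀ * l := mul_le_mul_of_nonneg_left (by nlinarith) hC₀.le
    linarith
  · obtain ⟨iX, eX⟩ := h.integral_driftTerm hl hlr hl1 heq1 heq2 heq4 ζ
    have hd := hdrift l hl hll1
    have e5 : (c₁ * ∫ s, ρ s * w l s ∂p).re =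
        -((∫ s, u l s * (starRingEnd ℂ) (w l s) ∂p) * (∫ s, ρ s * w l s ∂p) /
          (1 - ∫ s, ρ s ∂p)).re := by
      rw [← Complex.neg_re, hc₁]
      congr 1
      ring
    rw [e5] at eX
    obtain ⟨i, e⟩ := h.integral_exp_increment_le (δ := 3 / 4 * D) hl hlr hl2 hC₀.le n1 n2 n4 hζ iX
      (by rw [eX]; linarith)
    refine ⟨i, e.trans ?_⟩
    rw [← hE, ← hm]
    have hsmall : l * (E * m) ≤ D / 2 := by
      rw [le_div_iff₀ (by positivity)] at hlD
      linarith
    have h6 : l ^ 4 * E * m ≤ l ^ 3 * (D / 2) := by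
      have := mul_le_mul_of_nonneg_left hsmall (pow_pos hl 3).le
      linarith [show l ^ 3 * (l * (E * m)) = l ^ 4 * E * m by ring]
    have h8 := Real.add_one_le_exp (-D * l ^ 3)
    linarith

end IsPerturbedRotation

/-! ### The complex form of the action on unit vectors -/

/-- The point of the circle as a complex number. -/
def toComplex (x : UnitCircle) : ℂ := ⟨x.1 0, x.1 1⟩

/-- The coefficient `U` in the complex form `A z = U z + W z̄` of a real matrix. -/
def linPart (A : Matrix (Fin 2) (Fin 2) ℝ) : ℂ := ⟨(A 0 0 + A 1 1) / 2, (A 1 0 - A 0 1) / 2⟩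

/-- The coefficient `W` in the complex form `A z = U z + W z̄` of a real matrix. -/
def antiPart (A : Matrix (Fin 2) (Fin 2) ℝ) : ℂ := ⟨(A 0 0 - A 1 1) / 2, (A 0 1 + A 1 0) / 2⟩

theorem sq_add_sq_eq_one (x : UnitCircle) : x.1 0 ^ 2 + x.1 1 ^ 2 = 1 := by
  have h := x.2
  rw [mem_sphere_zero_iff_norm, EuclideanSpace.norm_eq, Fin.sum_univ_two,
    Real.sqrt_eq_one] at h
  simpa using h

theorem normSq_toComplex (x : UnitCircle) : Complex.normSq (toComplex x) = 1 := by
  rw [Complex.normSq_apply, toComplex]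
  linear_combination sq_add_sq_eq_one x

theorem norm_toComplex (x : UnitCircle) : ‖toComplex x‖ = 1 := by
  have := Complex.normSq_eq_norm_sq (toComplex x)
  rw [normSq_toComplex] at this
  exact (pow_eq_one_iff_of_nonneg (norm_nonneg _) two_ne_zero).1 this.symm

theorem norm_toComplex_sq (x : UnitCircle) : ‖toComplex x ^ 2‖ = 1 := by
  rw [norm_pow, norm_toComplex, one_pow]

theorem norm_linPart_sq (A : SL2R) : ‖linPart A‖ ^ 2 = 1 + ‖antiPart A‖ ^ 2 := by
  have h := A.det_coe
  rw [Matrix.det_fin_two] at h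
  rw [← Complex.normSq_eq_norm_sq, ← Complex.normSq_eq_norm_sq, Complex.normSq_apply,
    Complex.normSq_apply, linPart, antiPart]
  linear_combination h

theorem applyVec_zero (A : SL2R) (x : UnitCircle) :
    applyVec A x 0 = A.1 0 0 * x.1 0 + A.1 0 1 * x.1 1 := by
  simp [applyVec]

theorem applyVec_one (A : SL2R) (x : UnitCircle) :
    applyVec A x 1 = A.1 1 0 * x.1 0 + A.1 1 1 * x.1 1 := by
  simp [applyVec]

theorem complex_applyVec (A : SL2R) (x : UnitCircle) :
    (⟨applyVec A x 0, applyVec A x 1⟩ : ℂ) =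
      linPart A * toComplex x + antiPart A * (starRingEnd ℂ) (toComplex x) := by
  apply Complex.ext
  · simp [applyVec_zero, linPart, antiPart, toComplex]; ring
  · simp [applyVec_one, linPart, antiPart, toComplex]; ring

theorem norm_applyVec (A : SL2R) (x : UnitCircle) :
    ‖applyVec A x‖ = ‖linPart A * toComplex x ^ 2 + antiPart A‖ := by
  have h1 : ‖applyVec A x‖ = ‖(⟨applyVec A x 0, applyVec A x 1⟩ : ℂ)‖ := by
    rw [EuclideanSpace.norm_eq, Fin.sum_univ_two, Complex.norm_def, Complex.normSq_apply]
    simp [sq]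
  have h2 : linPart A * toComplex x ^ 2 + antiPart A =
      (linPart A * toComplex x + antiPart A * (starRingEnd ℂ) (toComplex x)) * toComplex x := by
    have := Complex.mul_conj (toComplex x)
    rw [normSq_toComplex, ofReal_one] at this
    linear_combination (-antiPart A) * this
  rw [h1, complex_applyVec, h2, norm_mul, norm_toComplex, mul_one]

theorem toComplex_circleAct (A : SL2R) (x : UnitCircle) :
    toComplex (circleAct A x) = ((‖applyVec A x‖⁻¹ : ℝ) : ℂ) *
      (linPart A * toComplex x + antiPart A * (starRingEnd ℂ) (toComplex x)) := by
  rw [← complex_applyVec]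
  apply Complex.ext <;> simp [toComplex, circleAct]

/-- On `ζ = z²` the group acts by Möbius transformations. -/
theorem toComplex_circleAct_sq (A : SL2R) (x : UnitCircle) :
    toComplex (circleAct A x) ^ 2 = moebius (linPart A) (antiPart A) (toComplex x ^ 2) := by
  have hn := norm_applyVec A x
  have hζ := norm_toComplex_sq x
  have hpos := norm_mul_add_pos (norm_linPart_sq A) hζ
  have hne : linPart A * toComplex x ^ 2 + antiPart A ≠ 0 := norm_pos_iff.1 hpos
  have hden : (starRingEnd ℂ) (linPart A) + (starRingEnd ℂ) (antiPart A) * toComplex x ^ 2 ≠ 0 := by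
    rw [← norm_pos_iff, norm_moebius_denom hζ]; exact hpos
  have hzc : toComplex x * (starRingEnd ℂ) (toComplex x) = 1 := by
    rw [Complex.mul_conj, normSq_toComplex, ofReal_one]
  rw [toComplex_circleAct, moebius, eq_div_iff hden, hn]
  set N := ‖linPart A * toComplex x ^ 2 + antiPart A‖ with hN
  have hN2 : ((N : ℝ) : ℂ) ^ 2 = (linPart A * toComplex x ^ 2 + antiPart A) *
      (starRingEnd ℂ) (linPart A * toComplex x ^ 2 + antiPart A) := by
    rw [Complex.mul_conj, Complex.normSq_eq_norm_sq, hN]; push_cast; ring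
  have hN0 : (N : ℂ) ≠ 0 := by exact_mod_cast hpos.ne'
  rw [ofReal_inv, mul_pow, inv_pow, mul_assoc, inv_mul_eq_iff_eq_mul₀ (pow_ne_zero 2 hN0), hN2]
  simp only [map_add, map_mul, map_pow]
  set z := toComplex x
  set z' := (starRingEnd ℂ) z
  set U := linPart A
  set W := antiPart A
  set U' := (starRingEnd ℂ) U
  set W' := (starRingEnd ℂ) W
  -- both sides agree once multiplied out with `z z̄ = 1`
  have e1 : U * z + W * z' = z' * (U * z ^ 2 + W) := by linear_combination (-U * z) * hzc
  have e2 : U' + W' * z ^ 2 = z ^ 2 * (U' * z' ^ 2 + W') := by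
    linear_combination (-U' * (z * z' + 1)) * hzc
  rw [e1, e2]
  linear_combination ((U * z ^ 2 + W) ^ 2 * (U' * z' ^ 2 + W')) * (z * z' + 1) * hzc

theorem moebius_mul {e u w ζ : ℂ} (he : ‖e‖ = 1) :
    moebius (e * u) (e * w) ζ = e ^ 2 * moebius u w ζ := by
  have hc : e * (starRingEnd ℂ) e = 1 := by
    rw [Complex.mul_conj, Complex.normSq_eq_norm_sq, he]; norm_num
  have he0 : (starRingEnd ℂ) e ≠ 0 := right_ne_zero_of_mul_eq_one hc
  rw [moebius, moebius, map_mul, map_mul]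
  have h1 : e * u * ζ + e * w = (starRingEnd ℂ) e * (e ^ 2 * (u * ζ + w)) := by
    linear_combination (-e * (u * ζ + w)) * hc
  have h2 : (starRingEnd ℂ) e * (starRingEnd ℂ) u + (starRingEnd ℂ) e * (starRingEnd ℂ) w * ζ =
    (starRingEnd ℂ) e * ((starRingEnd ℂ) u + (starRingEnd ℂ) w * ζ) := by ring
  rw [h1, h2, mul_div_mul_left _ _ he0, mul_div_assoc]

theorem circleDist_eq_abs (x y : UnitCircle) :
    circleDist x y = |x.1 0 * y.1 1 - x.1 1 * y.1 0| := by
  rw [circleDist, ← Real.sqrt_sq_eq_abs]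
  congr 1
  have hi : inner ℝ (x : EuclideanSpace ℝ (Fin 2)) (y : EuclideanSpace ℝ (Fin 2)) =
      x.1 0 * y.1 0 + x.1 1 * y.1 1 := by
    simp [PiLp.inner_apply, Fin.sum_univ_two, mul_comm]
  rw [hi]
  linear_combination -sq_add_sq_eq_one x - sq_add_sq_eq_one y * (x.1 0 ^ 2 + x.1 1 ^ 2)

theorem circleDist_nonneg (x y : UnitCircle) : 0 ≤ circleDist x y := Real.sqrt_nonneg _

theorem circleDist_le_one (x y : UnitCircle) : circleDist x y ≤ 1 := by
  rw [circleDist, Real.sqrt_le_one]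
  linarith [sq_nonneg (inner ℝ (x : EuclideanSpace ℝ (Fin 2)) (y : EuclideanSpace ℝ (Fin 2)))]

theorem norm_applyVec_pos (A : SL2R) (x : UnitCircle) : 0 < ‖applyVec A x‖ :=
  norm_pos_iff.2 (applyVec_ne_zero A x)

/-- Matrices of determinant one preserve areas, which determines the distortion of `δ`. -/
theorem circleDist_circleAct (A : SL2R) (x y : UnitCircle) :
    circleDist (circleAct A x) (circleAct A y) =
      circleDist x y * ‖applyVec A x‖⁻¹ * ‖applyVec A y‖⁻¹ := by
  have h := A.det_coe
  rw [Matrix.det_fin_two] at h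
  have e : ∀ (x : UnitCircle) (i : Fin 2),
    (circleAct A x).1 i = ‖applyVec A x‖⁻¹ * applyVec A x i := fun x i => by simp [circleAct]
  rw [circleDist_eq_abs, circleDist_eq_abs, e, e, e, e, applyVec_zero, applyVec_one, applyVec_zero,
    applyVec_one]
  have hx := norm_applyVec_pos A x
  have hy := norm_applyVec_pos A y
  rw [← abs_of_pos (inv_pos.2 hx), ← abs_of_pos (inv_pos.2 hy), ← abs_mul, ← abs_mul,
    abs_of_pos (inv_pos.2 hx), abs_of_pos (inv_pos.2 hy)]
  congr 1
  linear_combination (‖applyVec A x‖⁻¹ * ‖applyVec A y‖⁻¹ *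
    (x.1 0 * y.1 1 - x.1 1 * y.1 0)) * h

theorem continuous_circleAct (A : SL2R) : Continuous (circleAct A) := by
  have h : Continuous (applyVec A) := by
    unfold applyVec
    fun_prop
  refine Continuous.subtype_mk ?_ _
  exact (h.norm.inv₀ fun x => (norm_applyVec_pos A x).ne').smul h

/-! ### The transfer operator on continuous functions -/

section Measurability

variable {S : Type*} [MeasurableSpace S] {A : S → SL2R}

theorem measurable_circleAct_uncurry
    (hA : ∀ i j : Fin 2, Measurable fun s => (A s : Matrix (Fin 2) (Fin 2) ℝ) i j) :
    Measurable fun q : S × UnitCircle => circleAct (A q.1) q.2 := by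
  have hc : ∀ i : Fin 2, Measurable fun q : S × UnitCircle => q.2.1 i := fun i =>
    (by fun_prop : Continuous fun x : UnitCircle => x.1 i).measurable.comp measurable_snd
  have h : Measurable fun q : S × UnitCircle => applyVec (A q.1) q.2 := by
    refine (WithLp.measurable_toLp 2 _).comp (measurable_pi_lambda _ fun i => ?_)
    simp only [Matrix.mulVec, dotProduct, Fin.sum_univ_two]
    exact (((hA i 0).comp measurable_fst).mul (hc 0)).add
      (((hA i 1).comp measurable_fst).mul (hc 1))
  exact Measurable.subtype_mk (h.norm.inv.smul h)

theorem measurable_circleAct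
    (hA : ∀ i j : Fin 2, Measurable fun s => (A s : Matrix (Fin 2) (Fin 2) ℝ) i j)
    (x : UnitCircle) : Measurable fun s => circleAct (A s) x := by
  have h := measurable_circleAct_uncurry hA
  have h2 := h.comp (measurable_prodMk_right (y := x))
  simpa only [Function.comp_def] using h2

variable {p : Measure S} [IsProbabilityMeasure p] {E : Type*} [NormedAddCommGroup E]

theorem exists_norm_le_of_continuous {f : UnitCircle → E} (hf : Continuous f) :
    ∃ B, ∀ x, ‖f x‖ ≤ B := by
  obtain ⟨B, hB⟩ := isCompact_univ.exists_bound_of_continuousOn hf.continuousOn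
  exact ⟨B, fun x => hB x trivial⟩

theorem integrable_comp_circleAct {f : UnitCircle → ℂ} (hf : Continuous f)
    (hA : ∀ i j : Fin 2, Measurable fun s => (A s : Matrix (Fin 2) (Fin 2) ℝ) i j)
    (x : UnitCircle) : Integrable (fun s => f (circleAct (A s) x)) p := by
  obtain ⟨B, hB⟩ := exists_norm_le_of_continuous hf
  exact (integrable_const B).mono'
    (hf.measurable.comp (measurable_circleAct hA x)).aestronglyMeasurable
    (Filter.Eventually.of_forall fun s => hB _)

/-- The transfer operator has the Feller property. -/
theorem continuous_transferOp {f : UnitCircle → ℂ} (hf : Continuous f)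
    (hA : ∀ i j : Fin 2, Measurable fun s => (A s : Matrix (Fin 2) (Fin 2) ℝ) i j) :
    Continuous (transferOp p A f) := by
  obtain ⟨B, hB⟩ := exists_norm_le_of_continuous hf
  refine continuous_of_dominated (bound := fun _ => B) (fun x => ?_) (fun x => ?_)
    (integrable_const B) ?_
  · exact (hf.measurable.comp (measurable_circleAct hA x)).aestronglyMeasurable
  · exact Filter.Eventually.of_forall fun s => hB _
  · exact Filter.Eventually.of_forall fun s => hf.comp (continuous_circleAct (A s))

theorem continuous_transferOp_iterate {f : UnitCircle → ℂ} (hf : Continuous f)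
    (hA : ∀ i j : Fin 2, Measurable fun s => (A s : Matrix (Fin 2) (Fin 2) ℝ) i j) (N : ℕ) :
    Continuous ((transferOp p A)^[N] f) := by
  induction N with
  | zero => exact hf
  | succ n ih =>
    rw [Function.iterate_succ_apply']
    exact continuous_transferOp ih hA

theorem integral_transferOp_iterate {f : UnitCircle → ℂ} (hf : Continuous f)
    (hA : ∀ i j : Fin 2, Measurable fun s => (A s : Matrix (Fin 2) (Fin 2) ℝ) i j)
    {ν : Measure UnitCircle} [IsProbabilityMeasure ν] (hν : IsInvariantMeasure p A ν) (N : ℕ) :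
    ∫ x, (transferOp p A)^[N] f x ∂ν = ∫ x, f x ∂ν := by
  have hint : ∀ {f : UnitCircle → ℂ}, Continuous f → Integrable f ν := fun hf => by
    obtain ⟨B, hB⟩ := exists_norm_le_of_continuous hf
    exact (integrable_const B).mono' hf.aestronglyMeasurable (Filter.Eventually.of_forall hB)
  have hstep : ∀ f : UnitCircle → ℂ, Continuous f →
      ∫ x, transferOp p A f x ∂ν = ∫ x, f x ∂ν := by
    intro f hf
    have hS := continuous_transferOp (p := p) hf hA
    apply Complex.ext
    · have h1 := hν ⟨fun x => (f x).re, Complex.continuous_re.comp hf⟩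
      have h2 : ∫ x, (f x).re ∂ν = (∫ x, f x ∂ν).re := integral_re (hint hf)
      have h3 : ∫ x, (transferOp p A f x).re ∂ν = (∫ x, transferOp p A f x ∂ν).re :=
        integral_re (hint hS)
      have h4 : ∀ x, (transferOp p A f x).re = ∫ s, (f (circleAct (A s) x)).re ∂p := fun x =>
        (integral_re (integrable_comp_circleAct hf hA x)).symm
      rw [← h2, ← h3]
      simp only [h4]
      exact h1.symm
    · have h1 := hν ⟨fun x => (f x).im, Complex.continuous_im.comp hf⟩
      have h2 : ∫ x, (f x).im ∂ν = (∫ x, f x ∂ν).im := integral_im (hint hf)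
      have h3 : ∫ x, (transferOp p A f x).im ∂ν = (∫ x, transferOp p A f x ∂ν).im :=
        integral_im (hint hS)
      have h4 : ∀ x, (transferOp p A f x).im = ∫ s, (f (circleAct (A s) x)).im ∂p := fun x =>
        (integral_im (integrable_comp_circleAct hf hA x)).symm
      rw [← h2, ← h3]
      simp only [h4]
      exact h1.symm
  induction N with
  | zero => rfl
  | succ n ih =>
    rw [Function.iterate_succ_apply', hstep _ (continuous_transferOp_iterate hf hA n), ih]

end Measurability

/-! ### Contraction of the Hölder seminorm -/

section Contraction

variable {S : Type*} [MeasurableSpace S] {p : Measure S} [IsProbabilityMeasure p] {A : S → SL2R}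
  {g : UnitCircle → ℝ} {α q : ℝ}

/-- The power `δ^α` of the distance, weighted with the corrector `g`. -/
def weightedDist (g : UnitCircle → ℝ) (α : ℝ) (x y : UnitCircle) : ℝ :=
  circleDist x y ^ α * Real.exp (α * (g x + g y))

/-- The distortion of the weighted distance factorizes over the two points; the inequality
between the means then leaves one-point functions only. -/
theorem weightedDist_circleAct_le (B : SL2R) (x y : UnitCircle) :
    weightedDist g α (circleAct B x) (circleAct B y) ≤ weightedDist g α x y *
      ((Real.exp (2 * α * (g (circleAct B x) - g x - Real.log ‖applyVec B x‖)) +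
        Real.exp (2 * α * (g (circleAct B y) - g y - Real.log ‖applyVec B y‖))) / 2) := by
  have hx := norm_applyVec_pos B x
  have hy := norm_applyVec_pos B y
  have hpow : ∀ a : ℝ, 0 < a → a⁻¹ ^ α = Real.exp (-(α * Real.log a)) := fun a ha => by
    rw [Real.rpow_def_of_pos (inv_pos.2 ha), Real.log_inv]
    congr 1; ring
  set X := g (circleAct B x) - g x - Real.log ‖applyVec B x‖ with hX
  set Y := g (circleAct B y) - g y - Real.log ‖applyVec B y‖ with hY
  have h1 : weightedDist g α (circleAct B x) (circleAct B y) = weightedDist g α x y *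
      (Real.exp (α * X) * Real.exp (α * Y)) := by
    rw [weightedDist, weightedDist, circleDist_circleAct,
      Real.mul_rpow (mul_nonneg (circleDist_nonneg _ _) (inv_pos.2 hx).le) (inv_pos.2 hy).le,
      Real.mul_rpow (circleDist_nonneg _ _) (inv_pos.2 hx).le, hpow _ hx, hpow _ hy]
    simp only [mul_assoc, ← Real.exp_add]
    congr 2
    rw [hX, hY]
    ring
  rw [h1]
  refine mul_le_mul_of_nonneg_left ?_
    (mul_nonneg (Real.rpow_nonneg (circleDist_nonneg _ _) _) (Real.exp_pos _).le)
  have e : ∀ Z : ℝ, Real.exp (2 * α * Z) = Real.exp (α * Z) ^ 2 := fun Z => by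
    rw [sq, ← Real.exp_add]; congr 1; ring
  rw [e, e]
  nlinarith [sq_nonneg (Real.exp (α * X) - Real.exp (α * Y))]

/-- One step contraction of the Hölder seminorm for the weighted distance. -/
theorem norm_transferOp_sub_le
    (hA : ∀ i j : Fin 2, Measurable fun s => (A s : Matrix (Fin 2) (Fin 2) ℝ) i j)
    (hint : ∀ x, Integrable (fun s => Real.exp (2 * α *
      (g (circleAct (A s) x) - g x - Real.log ‖applyVec (A s) x‖))) p)
    (hq : ∀ x, ∫ s, Real.exp (2 * α *
      (g (circleAct (A s) x) - g x - Real.log ‖applyVec (A s) x‖)) ∂p ≤ q)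
    {f : UnitCircle → ℂ} (hf : Continuous f) {K : ℝ} (hK : 0 ≤ K)
    (hfK : ∀ x y, ‖f x - f y‖ ≤ K * weightedDist g α x y) (x y : UnitCircle) :
    ‖transferOp p A f x - transferOp p A f y‖ ≤ (q * K) * weightedDist g α x y := by
  have hW : 0 ≤ weightedDist g α x y :=
    mul_nonneg (Real.rpow_nonneg (circleDist_nonneg _ _) _) (Real.exp_pos _).le
  rw [transferOp, transferOp, ← integral_sub (integrable_comp_circleAct hf hA x)
    (integrable_comp_circleAct hf hA y)]
  have hI := (((hint x).add (hint y)).div_const 2).const_mul (K * weightedDist g α x y)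
  refine (norm_integral_le_of_norm_le hI (Filter.Eventually.of_forall fun s => ?_)).trans ?_
  · refine (hfK _ _).trans ?_
    rw [mul_assoc]
    exact mul_le_mul_of_nonneg_left (weightedDist_circleAct_le (A s) x y) hK
  · rw [integral_const_mul, integral_div, integral_add' (hint x) (hint y)]
    have h2 := add_le_add (hq x) (hq y)
    have := mul_le_mul_of_nonneg_left ((div_le_div_iff_of_pos_right (two_pos (α := ℝ))).2 h2)
      (mul_nonneg hK hW)
    exact this.trans (le_of_eq (by ring))

/-- Iterated contraction, in terms of the unweighted distance. The weight costs a factor that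
does not grow with the number of steps. -/
theorem norm_transferOp_iterate_sub_le
    (hA : ∀ i j : Fin 2, Measurable fun s => (A s : Matrix (Fin 2) (Fin 2) ℝ) i j)
    (hint : ∀ x, Integrable (fun s => Real.exp (2 * α *
      (g (circleAct (A s) x) - g x - Real.log ‖applyVec (A s) x‖))) p)
    (hq : ∀ x, ∫ s, Real.exp (2 * α *
      (g (circleAct (A s) x) - g x - Real.log ‖applyVec (A s) x‖)) ∂p ≤ q) (hq0 : 0 ≤ q)
    (hα : 0 ≤ α) {G : ℝ} (hG : ∀ x, |g x| ≤ G)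
    {f : UnitCircle → ℂ} (hf : Continuous f) {K : ℝ} (hK : 0 ≤ K)
    (hfK : ∀ x y, ‖f x - f y‖ ≤ K * circleDist x y ^ α) (N : ℕ) (x y : UnitCircle) :
    ‖(transferOp p A)^[N] f x - (transferOp p A)^[N] f y‖ ≤
      Real.exp (4 * α * G) * q ^ N * K * circleDist x y ^ α := by
  have key : ∀ N : ℕ, ∀ x y, ‖(transferOp p A)^[N] f x - (transferOp p A)^[N] f y‖ ≤
      (q ^ N * (Real.exp (2 * α * G) * K)) * weightedDist g α x y := by
    intro N
    induction N with
    | zero =>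
      intro x y
      refine (hfK x y).trans ?_
      have h1 : 1 ≤ Real.exp (2 * α * G) * Real.exp (α * (g x + g y)) := by
        rw [← Real.exp_add]
        apply Real.one_le_exp
        have h2 := (abs_le.1 (hG x)).1
        have h3 := (abs_le.1 (hG y)).1
        nlinarith
      have h4 : 0 ≤ K * circleDist x y ^ α :=
        mul_nonneg hK (Real.rpow_nonneg (circleDist_nonneg _ _) _)
      rw [weightedDist]
      calc K * circleDist x y ^ α ≤ (K * circleDist x y ^ α) *
            (Real.exp (2 * α * G) * Real.exp (α * (g x + g y))) := le_mul_of_one_le_right h4 h1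
        _ = _ := by ring
    | succ n ih =>
      intro x y
      rw [Function.iterate_succ_apply']
      refine (norm_transferOp_sub_le hA hint hq (continuous_transferOp_iterate hf hA n)
        (by positivity) ih x y).trans (le_of_eq ?_)
      ring
  refine (key N x y).trans ?_
  have h1 : Real.exp (α * (g x + g y)) ≤ Real.exp (2 * α * G) := by
    apply Real.exp_le_exp.2
    have h2 := (abs_le.1 (hG x)).2
    have h3 := (abs_le.1 (hG y)).2
    nlinarith
  have h5 : 0 ≤ circleDist x y ^ α := Real.rpow_nonneg (circleDist_nonneg _ _) _
  rw [weightedDist]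
  calc q ^ N * (Real.exp (2 * α * G) * K) * (circleDist x y ^ α * Real.exp (α * (g x + g y)))
      ≤ q ^ N * (Real.exp (2 * α * G) * K) * (circleDist x y ^ α * Real.exp (2 * α * G)) := by
        gcongr
    _ = (Real.exp (2 * α * G) * Real.exp (2 * α * G)) * q ^ N * K * circleDist x y ^ α := by ring
    _ = _ := by rw [← Real.exp_add]; congr 4; ring

/-- Oscillation controls the distance to the invariant mean. -/
theorem norm_sub_meanOp_le
    (hA : ∀ i j : Fin 2, Measurable fun s => (A s : Matrix (Fin 2) (Fin 2) ℝ) i j)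
    {ν : Measure UnitCircle} [IsProbabilityMeasure ν] (hν : IsInvariantMeasure p A ν)
    (hα : 0 ≤ α) {f : UnitCircle → ℂ} (hf : Continuous f) {K : ℝ} (hK : 0 ≤ K) (N : ℕ)
    (hfK : ∀ x y, ‖(transferOp p A)^[N] f x - (transferOp p A)^[N] f y‖ ≤ K * circleDist x y ^ α)
    (x : UnitCircle) : ‖(transferOp p A)^[N] f x - ∫ y, f y ∂ν‖ ≤ K := by
  have hc := continuous_transferOp_iterate (p := p) hf hA N
  have hi : Integrable ((transferOp p A)^[N] f) ν := by
    obtain ⟨B, hB⟩ := exists_norm_le_of_continuous hc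
    exact (integrable_const B).mono' hc.aestronglyMeasurable (Filter.Eventually.of_forall hB)
  have e : (transferOp p A)^[N] f x - ∫ y, f y ∂ν =
      ∫ y, ((transferOp p A)^[N] f x - (transferOp p A)^[N] f y) ∂ν := by
    rw [integral_sub (integrable_const _) hi, integral_transferOp_iterate hf hA hν N]
    simp
  rw [e]
  refine (norm_integral_le_of_norm_le_const (Filter.Eventually.of_forall fun y => ?_)).trans
    (le_of_eq (by rw [probReal_univ, mul_one]))
  refine (hfK x y).trans (mul_le_of_le_one_right hK ?_)
  exact Real.rpow_le_one (circleDist_nonneg _ _) (circleDist_le_one _ _) hα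

theorem norm_sub_le_of_holderSeminorm (hα : 0 < α) {f : UnitCircle → ℂ}
    (hf : holderSeminorm α f ≠ ∞) (x y : UnitCircle) :
    ‖f x - f y‖ ≤ (holderSeminorm α f).toReal * circleDist x y ^ α := by
  have h1 : ‖f x - f y‖ₑ / ENNReal.ofReal (circleDist x y) ^ α ≤ holderSeminorm α f :=
    le_iSup₂ (f := fun x y => ‖f x - f y‖ₑ / ENNReal.ofReal (circleDist x y) ^ α) x y
  have h2 : ENNReal.ofReal (circleDist x y) ^ α = ENNReal.ofReal (circleDist x y ^ α) :=
    ENNReal.ofReal_rpow_of_nonneg (circleDist_nonneg _ _) hα.le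
  have h0 : 0 ≤ circleDist x y ^ α := Real.rpow_nonneg (circleDist_nonneg _ _) _
  have h3 : ‖f x - f y‖ₑ ≤ holderSeminorm α f * ENNReal.ofReal (circleDist x y ^ α) := by
    rw [h2] at h1
    exact (ENNReal.div_le_iff_le_mul (Or.inr hf) (Or.inl ENNReal.ofReal_ne_top)).1 h1
  have h4 := ENNReal.toReal_mono (ENNReal.mul_ne_top hf ENNReal.ofReal_ne_top) h3
  rwa [ENNReal.toReal_mul, ENNReal.toReal_ofReal h0, toReal_enorm] at h4

theorem holderSeminorm_le (hα : 0 ≤ α) {f : UnitCircle → ℂ} {K : ℝ} (hK : 0 ≤ K)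
    (hf : ∀ x y, ‖f x - f y‖ ≤ K * circleDist x y ^ α) :
    holderSeminorm α f ≤ ENNReal.ofReal K := by
  refine iSup₂_le fun x y => ENNReal.div_le_of_le_mul ?_
  rw [ENNReal.ofReal_rpow_of_nonneg (circleDist_nonneg _ _) hα, ← ENNReal.ofReal_mul hK,
    ← ofReal_norm]
  exact ENNReal.ofReal_le_ofReal (hf x y)

/-- The spectral gap on the Hölder space, from an exponential moment below one of the corrected
norm cocycle. -/
theorem circleHolderNorm_iterate_sub_le
    (hA : ∀ i j : Fin 2, Measurable fun s => (A s : Matrix (Fin 2) (Fin 2) ℝ) i j)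
    (hint : ∀ x, Integrable (fun s => Real.exp (2 * α *
      (g (circleAct (A s) x) - g x - Real.log ‖applyVec (A s) x‖))) p)
    (hq : ∀ x, ∫ s, Real.exp (2 * α *
      (g (circleAct (A s) x) - g x - Real.log ‖applyVec (A s) x‖)) ∂p ≤ q) (hq0 : 0 ≤ q)
    (hα : 0 < α) {G : ℝ} (hG : ∀ x, |g x| ≤ G)
    {ν : Measure UnitCircle} [IsProbabilityMeasure ν] (hν : IsInvariantMeasure p A ν)
    {f : UnitCircle → ℂ} (hf : f ∈ HolderSpace α) (N : ℕ) :
    circleHolderNorm α ((transferOp p A)^[N] f - meanOp ν f) ≤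
      ENNReal.ofReal (Real.exp (4 * α * G) * q ^ N) * circleHolderNorm α f := by
  have hfin : holderSeminorm α f ≠ ∞ := ((le_max_right _ _).trans_lt hf.2).ne
  set m := (holderSeminorm α f).toReal with hm
  have hm0 : 0 ≤ m := ENNReal.toReal_nonneg
  have h1 := norm_transferOp_iterate_sub_le hA hint hq hq0 hα.le hG hf.1 hm0
    (norm_sub_le_of_holderSeminorm hα hfin) N
  set Q := Real.exp (4 * α * G) * q ^ N with hQ
  have hQ0 : 0 ≤ Q := by positivity
  have h2 := norm_sub_meanOp_le hA hν hα.le hf.1 (mul_nonneg hQ0 hm0) N h1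
  have h3 : ENNReal.ofReal (Q * m) ≤ ENNReal.ofReal Q * circleHolderNorm α f := by
    rw [ENNReal.ofReal_mul hQ0, hm, ENNReal.ofReal_toReal hfin]
    gcongr
    exact le_max_right _ _
  refine le_trans (max_le (iSup_le fun x => ?_) ?_) h3
  · rw [← ofReal_norm]
    exact ENNReal.ofReal_le_ofReal (h2 x)
  · refine holderSeminorm_le hα.le (mul_nonneg hQ0 hm0) fun x y => ?_
    simpa [meanOp] using h1 x y

end Contraction

/-! ### Invariant measures and random orbits -/

section Orbit

theorem randomOrbit_congr {S : Type*} {A : S → SL2R} (x : UnitCircle) {ω ω' : ℕ → S} {n : ℕ} (h : ∀ i < n, ω i = ω' i) :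
    randomOrbit A x ω n = randomOrbit A x ω' n := by
  induction n with
  | zero => rfl
  | succ n ih =>
    rw [randomOrbit, randomOrbit, ih fun i hi => h i (by omega), h n (by omega)]

variable {S : Type*} [MeasurableSpace S] {p : Measure S} [IsProbabilityMeasure p] {A : S → SL2R}

theorem integral_map_circleAct_prod
    (hA : ∀ i j : Fin 2, Measurable fun s => (A s : Matrix (Fin 2) (Fin 2) ℝ) i j)
    {f : UnitCircle → ℂ} (hf : Continuous f) (μ : Measure UnitCircle) [IsProbabilityMeasure μ] :
    ∫ q, f (circleAct (A q.1) q.2) ∂(p.prod μ) = ∫ x, transferOp p A f x ∂μ := by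
  obtain ⟨B, hB⟩ := exists_norm_le_of_continuous hf
  have hi : Integrable (fun q : S × UnitCircle => f (circleAct (A q.1) q.2)) (p.prod μ) :=
    (integrable_const B).mono'
      (hf.measurable.comp (measurable_circleAct_uncurry hA)).aestronglyMeasurable
      (Filter.Eventually.of_forall fun q => hB _)
  exact integral_prod_symm _ hi

open Filter Topology in
/-- Krylov–Bogoliubov: the limit of the averaged laws along an ultrafilter is invariant. -/
theorem exists_isInvariantMeasure
    (hA : ∀ i j : Fin 2, Measurable fun s => (A s : Matrix (Fin 2) (Fin 2) ℝ) i j) :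
    ∃ ν : Measure UnitCircle, IsProbabilityMeasure ν ∧ IsInvariantMeasure p A ν := by
  have hmeas := measurable_circleAct_uncurry hA
  obtain ⟨law, hlaw_zero, hlaw_succ⟩ : ∃ law : ℕ → Measure UnitCircle,
      law 0 = Measure.dirac (unitVec 0) ∧ ∀ n, law (n + 1) =
        (p.prod (law n)).map fun q : S × UnitCircle => circleAct (A q.1) q.2 :=
    ⟨fun n => Nat.rec (Measure.dirac (unitVec 0))
      (fun _ μ => (p.prod μ).map fun q : S × UnitCircle => circleAct (A q.1) q.2) n,
      rfl, fun n => rfl⟩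
  have hprob : ∀ n, IsProbabilityMeasure (law n) := by
    intro n
    induction n with
    | zero => rw [hlaw_zero]; exact Measure.dirac.isProbabilityMeasure
    | succ n ih =>
      rw [hlaw_succ]
      exact Measure.isProbabilityMeasure_map (μ := p.prod (law n)) hmeas.aemeasurable
  have hstep : ∀ (n : ℕ) {f : UnitCircle → ℂ}, Continuous f →
      ∫ x, f x ∂(law (n + 1)) = ∫ x, transferOp p A f x ∂(law n) := by
    intro n f hf
    have := hprob n
    rw [hlaw_succ, integral_map hmeas.aemeasurable hf.aestronglyMeasurable]
    exact integral_map_circleAct_prod hA hf _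
  let avg : ℕ → Measure UnitCircle := fun n =>
    ((n + 1 : ℕ) : ℝ≥0∞)⁻¹ • ∑ k ∈ Finset.range (n + 1), law k
  have havg : ∀ n, IsProbabilityMeasure (avg n) := by
    intro n
    constructor
    simp only [avg, Measure.smul_apply, Measure.finsetSum_apply, measure_univ, smul_eq_mul,
      Finset.sum_const, Finset.card_range, nsmul_eq_mul, mul_one]
    exact ENNReal.inv_mul_cancel (by simp) (ENNReal.natCast_ne_top _)
  have hint : ∀ {f : UnitCircle → ℂ} (μ : Measure UnitCircle) [IsProbabilityMeasure μ],
      Continuous f → Integrable f μ := fun μ _ hf => by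
    obtain ⟨B, hB⟩ := exists_norm_le_of_continuous hf
    exact (integrable_const B).mono' hf.aestronglyMeasurable (Eventually.of_forall hB)
  have hintavg : ∀ (n : ℕ) {f : UnitCircle → ℂ}, Continuous f →
      ∫ x, f x ∂(avg n) = ((n + 1 : ℕ) : ℂ)⁻¹ * ∑ k ∈ Finset.range (n + 1), ∫ x, f x ∂(law k) := by
    intro n f hf
    simp only [avg]
    rw [integral_smul_measure, integral_finsetSum_measure fun k _ => hint (law k) hf,
      ENNReal.toReal_inv, ENNReal.toReal_natCast, Complex.real_smul, ofReal_inv, ofReal_natCast]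
  let avgP : ℕ → ProbabilityMeasure UnitCircle := fun n => ⟨avg n, havg n⟩
  let U : Ultrafilter (ProbabilityMeasure UnitCircle) := (hyperfilter ℕ).map avgP
  obtain ⟨ν, -, hν⟩ := isCompact_univ.ultrafilter_le_nhds U (by simp)
  have hlim : Tendsto avgP (hyperfilter ℕ : Filter ℕ) (𝓝 ν) := hν
  have hlim' := ProbabilityMeasure.tendsto_iff_forall_integral_tendsto.1 hlim
  refine ⟨ν, inferInstance, fun f => ?_⟩
  -- view the real function as a complex one to use the transfer operator
  set h : UnitCircle → ℂ := fun x => (f x : ℂ) with hh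
  have hcont : Continuous h := Complex.continuous_ofReal.comp f.continuous
  have hSre : ∀ x, transferOp p A h x = ((∫ s, f (circleAct (A s) x) ∂p : ℝ) : ℂ) := fun x =>
    integral_ofReal
  have hScont : Continuous fun x => ∫ s, f (circleAct (A s) x) ∂p := by
    have := Complex.continuous_re.comp (continuous_transferOp (p := p) hcont hA)
    refine this.congr fun x => ?_
    simp only [Function.comp, hSre, ofReal_re]
  have l1 := hlim' (BoundedContinuousFunction.mkOfCompact f)
  have l2 := hlim' (BoundedContinuousFunction.mkOfCompact ⟨_, hScont⟩)
  have l3 := l2.sub l1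
  simp only [BoundedContinuousFunction.mkOfCompact_apply, ContinuousMap.coe_mk] at l3
  obtain ⟨B, hB⟩ := exists_norm_le_of_continuous hcont
  have hbound : ∀ n : ℕ, ‖∫ x, (∫ s, f (circleAct (A s) x) ∂p) ∂(avg n) - ∫ x, f x ∂(avg n)‖ ≤
      2 * B * (1 / ((n : ℝ) + 1)) := by
    intro n
    have e : ((∫ x, (∫ s, f (circleAct (A s) x) ∂p) ∂(avg n) - ∫ x, f x ∂(avg n) : ℝ) : ℂ) =
        ((n + 1 : ℕ) : ℂ)⁻¹ * (∫ x, h x ∂(law (n + 1)) - ∫ x, h x ∂(law 0)) := by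
      rw [ofReal_sub, ← integral_complex_ofReal, ← integral_complex_ofReal]
      simp only [← hSre]
      rw [hintavg n (continuous_transferOp hcont hA), hintavg n hcont, ← mul_sub,
        ← Finset.sum_sub_distrib]
      simp only [← hstep _ hcont]
      rw [Finset.sum_range_sub fun k => ∫ x, h x ∂(law k)]
    rw [← Complex.norm_real, e, norm_mul, norm_inv, Complex.norm_natCast]
    have hk : ∀ k, ‖∫ x, h x ∂(law k)‖ ≤ B := fun k => by
      have := hprob k
      refine (norm_integral_le_of_norm_le_const (Eventually.of_forall hB)).trans ?_
      rw [probReal_univ, mul_one]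
    have h2 := (norm_sub_le (∫ x, h x ∂(law (n + 1))) (∫ x, h x ∂(law 0))).trans
      (add_le_add (hk (n + 1)) (hk 0))
    push_cast
    rw [one_div, mul_comm (2 * B)]
    exact mul_le_mul_of_nonneg_left (by linarith) (by positivity)
  have l4 : Tendsto (fun n : ℕ => ∫ x, (∫ s, f (circleAct (A s) x) ∂p) ∂(avg n) -
      ∫ x, f x ∂(avg n)) (hyperfilter ℕ : Filter ℕ) (𝓝 0) := by
    have h0 : Tendsto (fun n : ℕ => 2 * B * (1 / ((n : ℝ) + 1))) atTop (𝓝 0) := by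
      simpa using (tendsto_one_div_add_atTop_nhds_zero_nat (𝕜 := ℝ)).const_mul (2 * B)
    exact (squeeze_zero_norm hbound h0).mono_left Nat.hyperfilter_le_atTop
  exact (sub_eq_zero.1 (tendsto_nhds_unique l3 l4)).symm

theorem measurable_randomOrbit
    (hA : ∀ i j : Fin 2, Measurable fun s => (A s : Matrix (Fin 2) (Fin 2) ℝ) i j)
    (x : UnitCircle) (n : ℕ) : Measurable fun ω : ℕ → S => randomOrbit A x ω n := by
  induction n with
  | zero => exact measurable_const
  | succ n ih =>
    have h1 : Measurable fun ω : ℕ → S => (ω n, randomOrbit A x ω n) :=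
      (measurable_pi_apply n).prodMk ih
    have h2 := (measurable_circleAct_uncurry hA).comp h1
    simpa only [Function.comp_def, randomOrbit] using h2

open ProbabilityTheory in
/-- The next random matrix is independent of the current position. -/
theorem indepFun_randomOrbit
    (hA : ∀ i j : Fin 2, Measurable fun s => (A s : Matrix (Fin 2) (Fin 2) ℝ) i j)
    (x : UnitCircle) (n : ℕ) :
    IndepFun (fun ω : ℕ → S => ω n) (fun ω => randomOrbit A x ω n)
      (Measure.infinitePi fun _ : ℕ => p) := by
  have hS : Nonempty S := p.nonempty_of_neZero
  have hind : iIndepFun (fun (i : ℕ) (ω : ℕ → S) => ω i) (Measure.infinitePi fun _ : ℕ => p) :=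
    iIndepFun_infinitePi (X := fun _ s => s) fun _ => measurable_id
  have h1 := hind.indepFun_finset {n} (Finset.range n) (by simp) fun i => measurable_pi_apply i
  -- the position after `n` steps is a function of the first `n` coordinates
  let ext : (Finset.range n → S) → ℕ → S := fun v i =>
    if h : i ∈ Finset.range n then v ⟨i, h⟩ else Classical.arbitrary S
  have hext : Measurable ext := by
    refine measurable_pi_lambda _ fun i => ?_
    by_cases h : i ∈ Finset.range n
    · simp only [ext, dif_pos h]
      exact measurable_pi_apply _
    · simp only [ext, dif_neg h]
      exact measurable_const
  have hev : Measurable fun v : ({n} : Finset ℕ) → S => v ⟨n, by simp⟩ := by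
    fun_prop
  have h2 := h1.comp (ψ := fun v => randomOrbit A x (ext v) n) hev ((measurable_randomOrbit hA x n).comp hext)
  refine h2.congr (Filter.EventuallyEq.rfl) (Filter.Eventually.of_forall fun ω => ?_)
  refine randomOrbit_congr x fun i hi => ?_
  simp only [ext, Finset.mem_range, hi, dite_true]

/-- The expectation along the random orbit is an iterate of the transfer operator. -/
theorem integral_randomOrbit
    (hA : ∀ i j : Fin 2, Measurable fun s => (A s : Matrix (Fin 2) (Fin 2) ℝ) i j)
    (x : UnitCircle) (n : ℕ) {f : UnitCircle → ℂ} (hf : Continuous f) :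
    ∫ ω, f (randomOrbit A x ω n) ∂(Measure.infinitePi fun _ : ℕ => p) =
      (transferOp p A)^[n] f x := by
  induction n generalizing f with
  | zero => simp [randomOrbit]
  | succ n ih =>
    have hY := measurable_randomOrbit hA x n
    have hX : Measurable fun ω : ℕ → S => ω n := measurable_pi_apply n
    have hlaw := (ProbabilityTheory.indepFun_iff_map_prod_eq_prod_map_map hX.aemeasurable
      hY.aemeasurable).1 (indepFun_randomOrbit (p := p) hA x n)
    rw [Measure.infinitePi_map_eval] at hlaw
    have hP : IsProbabilityMeasure ((Measure.infinitePi fun _ : ℕ => p).map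
        fun ω => randomOrbit A x ω n) := Measure.isProbabilityMeasure_map hY.aemeasurable
    have hF := hf.measurable.comp (measurable_circleAct_uncurry hA)
    rw [Function.iterate_succ_apply, ← ih (continuous_transferOp hf hA),
      ← integral_map hY.aemeasurable (continuous_transferOp hf hA).aestronglyMeasurable,
      ← integral_map_circleAct_prod hA hf, ← hlaw,
      integral_map (f := fun q : S × UnitCircle => f (circleAct (A q.1) q.2))
        (hX.prodMk hY).aemeasurable hF.aestronglyMeasurable]
    rfl

end Orbit

/-! ### Even functions with bounded angular derivative -/

section Smooth

theorem exists_unitVec_eq (x : UnitCircle) : ∃ θ : ℝ, unitVec θ = x := by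
  refine ⟨(toComplex x).arg, ?_⟩
  have h0 : toComplex x ≠ 0 := by
    rw [← norm_pos_iff, norm_toComplex]; exact one_pos
  apply Subtype.ext
  ext i
  fin_cases i
  · change Real.cos (toComplex x).arg = (toComplex x).re
    rw [Complex.cos_arg h0, norm_toComplex, div_one]
  · change Real.sin (toComplex x).arg = (toComplex x).im
    rw [Complex.sin_arg, norm_toComplex, div_one]

theorem circleDist_unitVec (a b : ℝ) : circleDist (unitVec a) (unitVec b) = |Real.sin (a - b)| := by
  rw [circleDist_eq_abs, Real.sin_sub, ← abs_neg]
  congr 1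
  simp [unitVec]

theorem unitVec_add_pi (θ : ℝ) : unitVec (θ + Real.pi) = -unitVec θ := by
  apply Subtype.ext
  ext i
  fin_cases i <;> simp [unitVec]

/-- An even function with bounded angular derivative is Lipschitz for `δ`: up to the sign of one
of the points, the angles differ by at most `π / 2`. -/
theorem norm_sub_le_of_deriv_le {f : UnitCircle → ℂ} {B : ℝ} (heven : ∀ x, f (-x) = f x)
    (hd : Differentiable ℝ fun θ : ℝ => f (unitVec θ))
    (hB : ∀ θ : ℝ, ‖deriv (fun θ' : ℝ => f (unitVec θ')) θ‖ ≤ B) (x y : UnitCircle) :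
    ‖f x - f y‖ ≤ 2 * B * circleDist x y := by
  obtain ⟨a, rfl⟩ := exists_unitVec_eq x
  obtain ⟨b, rfl⟩ := exists_unitVec_eq y
  have hB0 : 0 ≤ B := (norm_nonneg _).trans (hB 0)
  have hper : Function.Periodic (fun θ : ℝ => f (unitVec θ)) Real.pi := fun θ => by
    simp only [unitVec_add_pi, heven]
  set n := round ((a - b) / Real.pi) with hn
  set b' := b + n * Real.pi with hb'
  have hfb : f (unitVec b') = f (unitVec b) := by
    have := hper.int_mul n b
    exact this
  have hab : |a - b'| ≤ Real.pi / 2 := by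
    have h1 := abs_sub_round ((a - b) / Real.pi)
    have h2 : a - b' = ((a - b) / Real.pi - n) * Real.pi := by
      rw [hb', sub_mul, div_mul_cancel₀ _ Real.pi_ne_zero]; ring
    rw [h2, abs_mul, abs_of_pos Real.pi_pos]
    nlinarith [Real.pi_pos]
  have hdist : circleDist (unitVec a) (unitVec b) = |Real.sin (a - b')| := by
    rw [circleDist_unitVec, hb', ← sub_sub, Real.sin_sub_int_mul_pi, abs_mul]
    simp
  have hsin : 2 / Real.pi * |a - b'| ≤ |Real.sin (a - b')| := by
    have h1 := Real.mul_le_sin (abs_nonneg (a - b')) hab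
    rw [Real.abs_sin_eq_sin_abs_of_abs_le_pi (hab.trans (by linarith [Real.pi_pos]))]
    exact h1
  have hmv : ‖f (unitVec a) - f (unitVec b')‖ ≤ B * ‖a - b'‖ :=
    Convex.norm_image_sub_le_of_norm_deriv_le (f := fun θ : ℝ => f (unitVec θ)) (s := Set.univ)
      (fun θ _ => hd θ) (fun θ _ => hB θ) convex_univ trivial trivial
  rw [hfb, Real.norm_eq_abs] at hmv
  rw [hdist]
  refine hmv.trans ?_
  have h3 : |a - b'| ≤ 2 * |Real.sin (a - b')| := by
    rw [div_mul_eq_mul_div, div_le_iff₀ Real.pi_pos] at hsin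
    nlinarith [Real.pi_le_four, abs_nonneg (Real.sin (a - b'))]
  nlinarith

theorem continuous_of_norm_sub_le {f : UnitCircle → ℂ} {K : ℝ}
    (h : ∀ x y, ‖f x - f y‖ ≤ K * circleDist x y) : Continuous f := by
  rw [continuous_iff_continuousAt]
  intro y
  rw [ContinuousAt, tendsto_iff_norm_sub_tendsto_zero]
  have hc : Continuous fun x => K * circleDist x y := by
    unfold circleDist
    fun_prop
  have h0 : K * circleDist y y = 0 := by
    rw [circleDist_eq_abs, mul_comm (y.1 0), sub_self, abs_zero, mul_zero]
  have := hc.tendsto y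
  rw [h0] at this
  exact squeeze_zero (fun _ => norm_nonneg _) (fun x => h x y) this

end Smooth

/-! ### The normal form of the random family -/

section NormalForm

theorem norm_linPart_le {X : Matrix (Fin 2) (Fin 2) ℝ} {t : ℝ} (h : ∀ i j, |X i j| ≤ t) :
    ‖linPart X‖ ≤ 2 * t := by
  refine (Complex.norm_le_abs_re_add_abs_im _).trans ?_
  have h1 := abs_add_le (X 0 0) (X 1 1)
  have h2 := abs_sub (X 1 0) (X 0 1)
  simp only [linPart, abs_div, abs_two]
  linarith [h 0 0, h 1 1, h 1 0, h 0 1]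

theorem norm_antiPart_le {X : Matrix (Fin 2) (Fin 2) ℝ} {t : ℝ} (h : ∀ i j, |X i j| ≤ t) :
    ‖antiPart X‖ ≤ 2 * t := by
  refine (Complex.norm_le_abs_re_add_abs_im _).trans ?_
  have h1 := abs_sub (X 0 0) (X 1 1)
  have h2 := abs_add_le (X 0 1) (X 1 0)
  simp only [antiPart, abs_div, abs_two]
  linarith [h 0 0, h 1 1, h 1 0, h 0 1]

theorem linPart_sub (X Y : Matrix (Fin 2) (Fin 2) ℝ) :
    linPart (X - Y) = linPart X - linPart Y := by
  apply Complex.ext <;> simp [linPart] <;> ring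

theorem antiPart_sub (X Y : Matrix (Fin 2) (Fin 2) ℝ) :
    antiPart (X - Y) = antiPart X - antiPart Y := by
  apply Complex.ext <;> simp [antiPart] <;> ring

theorem abs_mul_mul_le (P Q X : Matrix (Fin 2) (Fin 2) ℝ) {t : ℝ} (h : ∀ i j, |X i j| ≤ t)
    (i j : Fin 2) : |(P * X * Q) i j| ≤ (∑ a, ∑ b, |P a b|) * (∑ a, ∑ b, |Q a b|) * t := by
  have ht : 0 ≤ t := (abs_nonneg _).trans (h 0 0)
  have hP : ∀ a, ∑ b, |P a b| ≤ ∑ a, ∑ b, |P a b| := fun a =>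
    Finset.single_le_sum (f := fun a => ∑ b, |P a b|)
      (fun a _ => Finset.sum_nonneg fun b _ => abs_nonneg _) (Finset.mem_univ a)
  have hQ : ∑ b, |Q b j| ≤ ∑ a, ∑ b, |Q a b| :=
    Finset.sum_le_sum fun a _ => Finset.single_le_sum (f := fun b => |Q a b|)
      (fun b _ => abs_nonneg _) (Finset.mem_univ j)
  have h1 : ∀ b, |(P * X) i b| ≤ (∑ a, ∑ b, |P a b|) * t := fun b => by
    rw [Matrix.mul_apply]
    refine (Finset.abs_sum_le_sum_abs _ _).trans ?_
    refine le_trans ?_ (mul_le_mul_of_nonneg_right (hP i) ht)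
    rw [Finset.sum_mul]
    refine Finset.sum_le_sum fun a _ => ?_
    rw [abs_mul]
    exact mul_le_mul_of_nonneg_left (h a b) (abs_nonneg _)
  have hP0 : 0 ≤ ∑ a, ∑ b, |P a b| :=
    Finset.sum_nonneg fun a _ => Finset.sum_nonneg fun b _ => abs_nonneg _
  rw [Matrix.mul_apply]
  refine (Finset.abs_sum_le_sum_abs _ _).trans ?_
  calc ∑ b, |(P * X) i b * Q b j| ≤ ∑ b, (∑ a, ∑ b, |P a b|) * t * |Q b j| := by
        refine Finset.sum_le_sum fun b _ => ?_
        rw [abs_mul]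
        exact mul_le_mul_of_nonneg_right (h1 b) (abs_nonneg _)
    _ = (∑ a, ∑ b, |P a b|) * t * ∑ b, |Q b j| := by rw [Finset.mul_sum]
    _ ≤ (∑ a, ∑ b, |P a b|) * t * ∑ a, ∑ b, |Q a b| :=
        mul_le_mul_of_nonneg_left hQ (mul_nonneg hP0 ht)
    _ = _ := by ring

theorem linPart_rotMatrix (θ : ℝ) : linPart (rotMatrix θ) = cexp (I * θ) := by
  rw [mul_comm, Complex.exp_mul_I, ← Complex.ofReal_cos, ← Complex.ofReal_sin]
  apply Complex.ext <;> simp [linPart, rotMatrix] <;> rfl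

theorem antiPart_rotMatrix (θ : ℝ) : antiPart (rotMatrix θ) = 0 := by
  apply Complex.ext <;> simp [antiPart, rotMatrix]

/-- A rotation on the left multiplies the antilinear coefficient by a phase. -/
theorem antiPart_inv_mul {B : SL2R} {θ : ℝ} (hB : (B : Matrix (Fin 2) (Fin 2) ℝ) = rotMatrix θ)
    (X : SL2R) : antiPart ((B⁻¹ * X : SL2R) : Matrix (Fin 2) (Fin 2) ℝ) =
      (starRingEnd ℂ) (linPart B) * antiPart X := by
  rw [Matrix.SpecialLinearGroup.coe_mul, Matrix.SpecialLinearGroup.coe_inv, hB,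
    Matrix.adjugate_fin_two]
  apply Complex.ext <;>
    simp [antiPart, linPart, rotMatrix, Matrix.mul_apply, Fin.sum_univ_two] <;> ring

theorem star_vVec_dotProduct_mulVec (P : Matrix (Fin 2) (Fin 2) ℝ) :
    star (star vVec) ⬝ᵥ (P.map (fun a : ℝ => (a : ℂ)) *ᵥ vVec) = (starRingEnd ℂ) (antiPart P) := by
  have h2 : ((Real.sqrt 2 : ℝ) : ℂ) * ((Real.sqrt 2 : ℝ) : ℂ) = 2 := by
    rw [← ofReal_mul, Real.mul_self_sqrt (by norm_num)]; norm_num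
  have h0 : ((Real.sqrt 2 : ℝ) : ℂ) ≠ 0 := by
    intro h; rw [h] at h2; norm_num at h2
  have h3 : (1 / ((Real.sqrt 2 : ℝ) : ℂ)) * (1 / ((Real.sqrt 2 : ℝ) : ℂ)) = 1 / 2 := by
    rw [div_mul_div_comm, h2, one_mul]
  have h4 : antiPart P = (((P 0 0 : ℝ) : ℂ) - P 1 1) / 2 + (((P 0 1 : ℝ) : ℂ) + P 1 0) / 2 * I := by
    apply Complex.ext <;> simp [antiPart]
  rw [star_star, h4]
  simp only [Matrix.mulVec, dotProduct, Fin.sum_univ_two, Matrix.map_apply, vVec,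
    Matrix.cons_val_zero, Matrix.cons_val_one, map_add, map_mul, map_sub, map_div₀,
    Complex.conj_ofReal, Complex.conj_I, map_ofNat]
  have h5 : -I / ((Real.sqrt 2 : ℝ) : ℂ) = -I * (1 / ((Real.sqrt 2 : ℝ) : ℂ)) := by ring
  rw [h5]
  linear_combination ((P 0 0 : ℂ) - I * P 0 1 - I * P 1 0 + I ^ 2 * P 1 1) * h3 +
    (P 1 1 : ℂ) / 2 * Complex.I_sq

variable {S : Type*} [MeasurableSpace S] {p : Measure S}
  {T : ℝ → S → SL2R} {M : SL2R} {η : S → ℝ}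

theorem measurable_conjFamily (hreg : IsRegularFamily p T) (M : SL2R) (l : ℝ) (i j : Fin 2) :
    Measurable fun s => (conjFamily M T l s : Matrix (Fin 2) (Fin 2) ℝ) i j := by
  simp only [conjFamily, Matrix.SpecialLinearGroup.coe_mul, Matrix.mul_apply]
  refine Finset.measurable_sum _ fun b _ => (Finset.measurable_sum _ fun a _ => ?_).mul_const _
  exact (hreg.measurable l a b).const_mul _

theorem measurable_linPart {A : S → SL2R}
    (hA : ∀ i j : Fin 2, Measurable fun s => (A s : Matrix (Fin 2) (Fin 2) ℝ) i j) :
    Measurable fun s => linPart (A s) := by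
  have : (fun s => linPart (A s)) = fun s => ((((A s).1 0 0 + (A s).1 1 1) / 2 : ℝ) : ℂ) +
      ((((A s).1 1 0 - (A s).1 0 1) / 2 : ℝ) : ℂ) * I := by
    funext s
    apply Complex.ext <;> simp [linPart]
  rw [this]
  have h00 := hA 0 0
  have h01 := hA 0 1
  have h10 := hA 1 0
  have h11 := hA 1 1
  fun_prop

theorem measurable_antiPart {A : S → SL2R}
    (hA : ∀ i j : Fin 2, Measurable fun s => (A s : Matrix (Fin 2) (Fin 2) ℝ) i j) :
    Measurable fun s => antiPart (A s) := by
  have : (fun s => antiPart (A s)) = fun s => ((((A s).1 0 0 - (A s).1 1 1) / 2 : ℝ) : ℂ) +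
      ((((A s).1 0 1 + (A s).1 1 0) / 2 : ℝ) : ℂ) * I := by
    funext s
    apply Complex.ext <;> simp [antiPart]
  rw [this]
  have h00 := hA 0 0
  have h01 := hA 0 1
  have h10 := hA 1 0
  have h11 := hA 1 1
  fun_prop

open Filter Topology in
/-- The first order coefficient of the antilinear part is the conjugate of `β`. -/
theorem tendsto_antiPart_div (hreg : IsRegularFamily p T)
    (hM : ∀ s : S, (conjFamily M T 0 s : Matrix (Fin 2) (Fin 2) ℝ) = rotMatrix (η s)) (s : S) :
    Tendsto (fun l : ℝ => (starRingEnd ℂ) (linPart (conjFamily M T 0 s)) *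
      antiPart (conjFamily M T l s) / (l : ℂ)) (𝓝[>] 0)
      (𝓝 ((starRingEnd ℂ) (betaCoeff M T s))) := by
  set F : ℝ → Matrix (Fin 2) (Fin 2) ℝ := fun l =>
    (((conjFamily M T 0 s)⁻¹ * conjFamily M T l s : SL2R) : Matrix (Fin 2) (Fin 2) ℝ) with hF
  have hFd : ∀ i j, HasDerivAt (fun l => F l i j) (firstOrderCoeff M T s i j) 0 := by
    intro i j
    have hdiff : DifferentiableAt ℝ (fun l => F l i j) 0 := by
      have hT : ∀ a b, DifferentiableAt ℝ
          (fun l : ℝ => (T l s : Matrix (Fin 2) (Fin 2) ℝ) a b) 0 := fun a b =>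
        ((hreg.smooth s a b).differentiable (by simp)).differentiableAt
      simp only [hF, conjFamily, Matrix.SpecialLinearGroup.coe_mul, Matrix.mul_apply,
        Fin.sum_univ_two]
      have h00 := hT 0 0
      have h01 := hT 0 1
      have h10 := hT 1 0
      have h11 := hT 1 1
      fun_prop
    exact hdiff.hasDerivAt
  have hG : HasDerivAt (fun l => antiPart (F l)) (antiPart (firstOrderCoeff M T s)) 0 := by
    have e : ∀ X : Matrix (Fin 2) (Fin 2) ℝ, antiPart X =
        (((X 0 0 - X 1 1) / 2 : ℝ) : ℂ) + (((X 0 1 + X 1 0) / 2 : ℝ) : ℂ) * I := fun X => by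
      apply Complex.ext <;> simp [antiPart]
    simp only [e]
    exact (((hFd 0 0).sub (hFd 1 1)).div_const 2).ofReal_comp.add
      ((((hFd 0 1).add (hFd 1 0)).div_const 2).ofReal_comp.mul_const I)
  have hF0 : antiPart (F 0) = 0 := by
    simp only [hF, inv_mul_cancel]
    apply Complex.ext <;> simp [antiPart]
  have hbeta : (starRingEnd ℂ) (betaCoeff M T s) = antiPart (firstOrderCoeff M T s) := by
    rw [betaCoeff, star_vVec_dotProduct_mulVec, Complex.conj_conj]
  rw [hbeta]
  have h1 := (hasDerivAt_iff_tendsto_slope.1 hG).mono_left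
    (nhdsWithin_mono 0 (fun x (hx : 0 < x) => (ne_of_gt hx : x ≠ 0)))
  refine h1.congr fun l => ?_
  rw [slope_def_module, hF0, sub_zero, sub_zero, hF]
  simp only
  rw [antiPart_inv_mul (hM s), Complex.real_smul, ofReal_inv]
  ring

/-- The random family is a perturbed rotation. The rotation on the left has bounded entries, so the
deviation is bounded by a multiple of the first power of the random variable in the assumption. -/
theorem exists_isPerturbedRotation [IsProbabilityMeasure p] (hreg : IsRegularFamily p T)
    (hM : ∀ s : S, (conjFamily M T 0 s : Matrix (Fin 2) (Fin 2) ℝ) = rotMatrix (η s)) :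
    ∃ (k : S → ℝ) (r : ℝ), IsPerturbedRotation p
      (fun l s => (starRingEnd ℂ) (linPart (conjFamily M T 0 s)) * linPart (conjFamily M T l s))
      (fun l s => (starRingEnd ℂ) (linPart (conjFamily M T 0 s)) * antiPart (conjFamily M T l s))
      (fun s => linPart (conjFamily M T 0 s) ^ 2)
      (fun s => (starRingEnd ℂ) (betaCoeff M T s)) k r := by
  obtain ⟨K, r, hK, hr, hb⟩ := hreg.moments
  set C := 2 * ((∑ a, ∑ b, |M.1 a b|) * (∑ a, ∑ b, |(M⁻¹).1 a b|)) with hC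
  have hC0 : 0 ≤ C := by positivity
  have hmeas := measurable_conjFamily hreg M
  have hnorm : ∀ s, ‖linPart (conjFamily M T 0 s)‖ = 1 := fun s => by
    rw [hM, linPart_rotMatrix, mul_comm, Complex.norm_exp_ofReal_mul_I]
  have hmc : Measurable fun s => (starRingEnd ℂ) (linPart (conjFamily M T 0 s)) :=
    Complex.continuous_conj.measurable.comp (measurable_linPart (hmeas 0))
  -- the mean value inequality for the entries
  have hT : ∀ s l, 0 < l → l ≤ r → ∀ i j,
      |((T l s).1 - (T 0 s).1) i j| ≤ l * |K s| := by
    intro s l hl hlr i j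
    have hmv := Convex.norm_image_sub_le_of_norm_deriv_le (𝕜 := ℝ)
      (f := fun l : ℝ => (T l s : Matrix (Fin 2) (Fin 2) ℝ) i j) (s := Set.Icc 0 l) (C := K s)
      (fun x _ => ((hreg.smooth s i j).differentiable (by simp)).differentiableAt)
      (fun x hx => by
        have := hb s x (by rw [abs_of_nonneg hx.1]; exact hx.2.trans hlr) 1 (by norm_num) i j
        rwa [iteratedDeriv_one] at this)
      (convex_Icc 0 l) (Set.left_mem_Icc.2 hl.le) (Set.right_mem_Icc.2 hl.le)
    rw [sub_zero, Real.norm_eq_abs, Real.norm_eq_abs, abs_of_pos hl] at hmv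
    rw [Matrix.sub_apply, mul_comm]
    exact hmv.trans (mul_le_mul_of_nonneg_right (le_abs_self _) hl.le)
  have hA : ∀ s l, 0 < l → l ≤ r → ∀ i j,
      |((conjFamily M T l s).1 - (conjFamily M T 0 s).1) i j| ≤ C / 2 * (l * |K s|) := by
    intro s l hl hlr i j
    have e : (conjFamily M T l s).1 - (conjFamily M T 0 s).1 =
        M.1 * ((T l s).1 - (T 0 s).1) * (M⁻¹).1 := by
      rw [mul_sub, sub_mul]
      rfl
    rw [e]
    refine (abs_mul_mul_le _ _ _ (hT s l hl hlr) i j).trans (le_of_eq ?_)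
    rw [hC]; ring
  refine ⟨fun s => 1 + C * |K s|, r, ?_⟩
  refine
    { r_pos := hr
      measurable_u := fun l => hmc.mul (measurable_linPart (hmeas l))
      measurable_w := fun l => hmc.mul (measurable_antiPart (hmeas l))
      measurable_rho := (measurable_linPart (hmeas 0)).pow_const 2
      one_le := fun s => by
        have := mul_nonneg hC0 (abs_nonneg (K s))
        linarith
      integrable_cube := ?_
      det := fun l s => ?_
      norm_rho := fun s => by rw [norm_pow, hnorm, one_pow]
      norm_w_le := fun l s hl hlr => ?_
      norm_u_le := fun l s hl hlr => ?_
      tendsto := fun s => tendsto_antiPart_div hreg hM s }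
  · have h3 : MemLp K 3 p := hK.mono_exponent (by norm_num)
    have h4 : MemLp (fun s => 1 + C * |K s|) 3 p :=
      (memLp_const (1 : ℝ)).add (h3.abs.const_mul C)
    have h5 := h4.integrable_norm_pow (by norm_num : (3 : ℕ) ≠ 0)
    refine h5.congr (Filter.Eventually.of_forall fun s => ?_)
    have := mul_nonneg hC0 (abs_nonneg (K s))
    simp only
    rw [Real.norm_eq_abs, abs_of_nonneg (by linarith)]
  · rw [norm_mul, norm_mul, RCLike.norm_conj, hnorm, one_mul, one_mul]
    exact norm_linPart_sq _
  · rw [norm_mul, RCLike.norm_conj, hnorm, one_mul]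
    have h0 : antiPart (conjFamily M T 0 s) = 0 := by rw [hM, antiPart_rotMatrix]
    have h1 := norm_antiPart_le (hA s l hl hlr)
    rw [antiPart_sub, h0, sub_zero] at h1
    refine h1.trans ?_
    linarith
  · have hc : (starRingEnd ℂ) (linPart (conjFamily M T 0 s)) * linPart (conjFamily M T 0 s) = 1 := by
      rw [mul_comm, Complex.mul_conj, Complex.normSq_eq_norm_sq, hnorm]; norm_num
    have h1 := norm_linPart_le (hA s l hl hlr)
    rw [linPart_sub] at h1
    rw [← hc, ← mul_sub, norm_mul, RCLike.norm_conj, hnorm, one_mul]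
    refine h1.trans ?_
    linarith

end NormalForm

/-! ### The spectral gap and the summed correlations -/

/-- Decay of the differences between the expectations along the orbit and the invariant mean
gives a geometric series. -/
theorem summable_and_norm_tsum_le {a : ℕ → ℂ} {K y : ℝ} (hK : 0 ≤ K) (hy : 0 < y)
    (ha : ∀ m, ‖a m‖ ≤ Real.exp (-y) ^ (m + 1) * K) :
    Summable a ∧ ‖∑' m, a m‖ ≤ K * y⁻¹ := by
  have hq0 : 0 < Real.exp (-y) := Real.exp_pos _
  have hq1 : Real.exp (-y) < 1 := Real.exp_lt_one_iff.2 (by linarith)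
  have hgeo := (hasSum_geometric_of_lt_one hq0.le hq1).mul_left (Real.exp (-y) * K)
  have ha' : ∀ m, ‖a m‖ ≤ Real.exp (-y) * K * Real.exp (-y) ^ m := fun m =>
    (ha m).trans (le_of_eq (by ring))
  refine ⟨Summable.of_norm_bounded hgeo.summable ha', ?_⟩
  refine (tsum_of_norm_bounded hgeo ha').trans ?_
  have h1 : Real.exp (-y) * (1 - Real.exp (-y))⁻¹ ≤ y⁻¹ := by
    have h2 := Real.add_one_le_exp y
    have h3 : Real.exp (-y) * Real.exp y = 1 := by rw [← Real.exp_add]; simp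
    rw [mul_inv_le_iff₀ (by linarith), ← div_eq_inv_mul, le_div_iff₀ hy]
    nlinarith
  calc _ = K * (Real.exp (-y) * (1 - Real.exp (-y))⁻¹) := by ring
    _ ≤ _ := mul_le_mul_of_nonneg_left h1 hK

section Corrector

variable {S : Type*} [MeasurableSpace S] {p : Measure S} [IsProbabilityMeasure p]
  {T : ℝ → S → SL2R} {M : SL2R} {η : S → ℝ}

/-- The corrector of the complex normal form, as a function on the circle of unit vectors. -/
theorem exists_circle_corrector (hreg : IsRegularFamily p T)
    (hM : ∀ s : S, (conjFamily M T 0 s : Matrix (Fin 2) (Fin 2) ℝ) = rotMatrix (η s))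
    (hη1 : ∫ s, cexp (2 * I * (η s : ℂ)) ∂p ≠ 1)
    (hη2 : ∫ s, cexp (4 * I * (η s : ℂ)) ∂p ≠ 1)
    (hD : 0 < coeffD p M T η) :
    ∃ G c l₀ : ℝ, 0 < G ∧ 0 < c ∧ 0 < l₀ ∧ l₀ ≤ 1 / 2 ∧ ∀ l : ℝ, 0 < l → l ≤ l₀ →
      ∃ g : UnitCircle → ℝ, (∀ x, |g x| ≤ G * l) ∧ ∀ x,
        Integrable (fun s => Real.exp (2 * l * (g (circleAct (conjFamily M T l s) x) - g x -
          Real.log ‖applyVec (conjFamily M T l s) x‖))) p ∧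
        ∫ s, Real.exp (2 * l * (g (circleAct (conjFamily M T l s) x) - g x -
          Real.log ‖applyVec (conjFamily M T l s) x‖)) ∂p ≤ Real.exp (-c * l ^ 3) := by
  obtain ⟨k, r, h⟩ := exists_isPerturbedRotation hreg hM
  have hlin : ∀ s, linPart (conjFamily M T 0 s) = cexp (I * η s) := fun s => by
    rw [hM, linPart_rotMatrix]
  have hρ : ∀ s, linPart (conjFamily M T 0 s) ^ 2 = cexp (2 * I * (η s : ℂ)) := fun s => by
    rw [hlin, ← Complex.exp_nat_mul]
    congr 1; push_cast; ring
  have hρ2 : ∀ s, (linPart (conjFamily M T 0 s) ^ 2) ^ 2 = cexp (4 * I * (η s : ℂ)) := fun s => by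
    rw [hρ, ← Complex.exp_nat_mul]
    congr 1; push_cast; ring
  obtain ⟨G, c, l₀, hG, hc, hl₀, hl₀', hmain⟩ := h.exists_corrector
    (by simpa only [hρ] using hη1) (by simpa only [hρ2] using hη2) (by
      simp only [hρ, RCLike.norm_conj, Complex.conj_conj, mul_comm (cexp _)]
      exact hD)
  refine ⟨G, c, l₀, hG, hc, hl₀, hl₀', fun l hl hll => ?_⟩
  obtain ⟨a₁, a₂, hg, hexp⟩ := hmain l hl hll
  refine ⟨fun x => trigPoly a₁ a₂ (toComplex x ^ 2), fun x => hg _ (norm_toComplex_sq x),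
    fun x => ?_⟩
  have key : ∀ s, trigPoly a₁ a₂ (toComplex (circleAct (conjFamily M T l s) x) ^ 2) -
      trigPoly a₁ a₂ (toComplex x ^ 2) - Real.log ‖applyVec (conjFamily M T l s) x‖ =
      trigPoly a₁ a₂ (linPart (conjFamily M T 0 s) ^ 2 *
        moebius ((starRingEnd ℂ) (linPart (conjFamily M T 0 s)) * linPart (conjFamily M T l s))
          ((starRingEnd ℂ) (linPart (conjFamily M T 0 s)) * antiPart (conjFamily M T l s))
          (toComplex x ^ 2)) - trigPoly a₁ a₂ (toComplex x ^ 2) -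
      Real.log ‖(starRingEnd ℂ) (linPart (conjFamily M T 0 s)) * linPart (conjFamily M T l s) *
        toComplex x ^ 2 +
        (starRingEnd ℂ) (linPart (conjFamily M T 0 s)) * antiPart (conjFamily M T l s)‖ := by
    intro s
    have hn : ‖linPart (conjFamily M T 0 s)‖ = 1 := by
      rw [hlin, mul_comm, Complex.norm_exp_ofReal_mul_I]
    have hc : linPart (conjFamily M T 0 s) * (starRingEnd ℂ) (linPart (conjFamily M T 0 s)) = 1 := by
      rw [Complex.mul_conj, Complex.normSq_eq_norm_sq, hn]; norm_num
    rw [← moebius_mul hn, ← mul_assoc, ← mul_assoc, hc, one_mul, one_mul,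
      toComplex_circleAct_sq, norm_applyVec, mul_assoc, ← mul_add, norm_mul, RCLike.norm_conj, hn,
      one_mul]
  simp only [key]
  exact hexp _ (norm_toComplex_sq x)

end Corrector

theorem exp_le_one_add_mul_sq {G l : ℝ} (hG : 0 ≤ G) (hl : 0 ≤ l) (hl1 : l ≤ 1) :
    Real.exp (4 * G * l ^ 2) ≤ 1 + 4 * G * Real.exp (4 * G) * l ^ 2 := by
  have hl2 : l ^ 2 ≤ 1 := pow_le_one₀ hl hl1
  have hy : 0 ≤ 4 * G * l ^ 2 := by positivity
  have hy4 : 4 * G * l ^ 2 ≤ 4 * G := mul_le_of_le_one_right (by positivity) hl2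
  have h1 := Real.add_one_le_exp (-(4 * G * l ^ 2))
  have h2 : (-(4 * G * l ^ 2) + 1) * Real.exp (4 * G * l ^ 2) ≤ 1 := by
    have := mul_le_mul_of_nonneg_right h1 (Real.exp_pos (4 * G * l ^ 2)).le
    rwa [← Real.exp_add, neg_add_cancel, Real.exp_zero] at this
  have h3 : 4 * G * l ^ 2 * Real.exp (4 * G * l ^ 2) ≤ 4 * G * l ^ 2 * Real.exp (4 * G) :=
    mul_le_mul_of_nonneg_left (Real.exp_le_exp.2 hy4) hy
  linarith

end

theorem proposition2 {S : Type*} [MeasurableSpace S] (p : Measure S) [IsProbabilityMeasure p]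
    (T : ℝ → S → SL2R) (hreg : IsRegularFamily p T) (hcrit : IsCriticalPoint T)
    (M : SL2R) (η : S → ℝ)
    (hM : ∀ s : S, (conjFamily M T 0 s : Matrix (Fin 2) (Fin 2) ℝ) = rotMatrix (η s))
    (hη1 : ∫ s, cexp (2 * I * (η s : ℂ)) ∂p ≠ 1)
    (hη2 : ∫ s, cexp (4 * I * (η s : ℂ)) ∂p ≠ 1)
    (hD : 0 < coeffD p M T η) :
    ∃ c d l₀ κ C : ℝ, 0 < c ∧ 0 < d ∧ 0 < l₀ ∧ 0 < κ ∧ 0 < C ∧ d * l₀ ≤ 1 ∧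
      ∀ l : ℝ, 0 < l → l ≤ l₀ →
      (∃ ν : Measure UnitCircle, IsProbabilityMeasure ν ∧
        IsInvariantMeasure p (conjFamily M T l) ν) ∧
      ∀ ν : Measure UnitCircle, IsProbabilityMeasure ν →
        IsInvariantMeasure p (conjFamily M T l) ν →
        -- the spectral gap estimate
        (∀ f ∈ HolderSpace (d * l), ∀ N : ℕ,
          (κ ≤ l * N →
            circleHolderNorm (d * l)
                ((transferOp p (conjFamily M T l))^[N] f - meanOp ν f) ≤
              circleHolderNorm (d * l) f * ENNReal.ofReal (Real.exp (-c * l ^ 3 * N))) ∧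
          circleHolderNorm (d * l)
              ((transferOp p (conjFamily M T l))^[N] f - meanOp ν f) ≤
            ENNReal.ofReal (1 + C * l ^ 2) * circleHolderNorm (d * l) f *
              ENNReal.ofReal (Real.exp (-c * l ^ 3 * N))) ∧
        -- the bound on the summed correlation decay
        (∀ (f : UnitCircle → ℂ) (B : ℝ), (∀ x, f (-x) = f x) →
          Differentiable ℝ (fun θ : ℝ => f (unitVec θ)) →
          (∀ x, ‖f x‖ ≤ B) → (∀ θ : ℝ, ‖deriv (fun θ' : ℝ => f (unitVec θ')) θ‖ ≤ B) →
          ∀ x : UnitCircle,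
            Summable (fun m : ℕ =>
              (∫ ω, f (randomOrbit (conjFamily M T l) x ω (m + 1))
                ∂(Measure.infinitePi fun _ : ℕ => p)) - ∫ y, f y ∂ν) ∧
            ‖∑' m : ℕ,
              ((∫ ω, f (randomOrbit (conjFamily M T l) x ω (m + 1))
                ∂(Measure.infinitePi fun _ : ℕ => p)) - ∫ y, f y ∂ν)‖ ≤
              C * B * (l ^ 3)⁻¹) := by
  obtain ⟨G, c, l₀, hG, hc, hl₀, hl₀', hmain⟩ := exists_circle_corrector hreg hM hη1 hη2 hD
  -- half of the contraction rate absorbs the weight `exp (4 G l²)` after `κ / l` steps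
  refine ⟨c / 2, 1, l₀, 8 * G / c, 4 * G * Real.exp (4 * G) + 2 * Real.exp (4 * G) / c,
    by positivity, one_pos, hl₀, by positivity, by positivity, by linarith, fun l hl hll => ?_⟩
  have hA := measurable_conjFamily hreg M l
  refine ⟨exists_isInvariantMeasure hA, fun ν hν hinv => ?_⟩
  obtain ⟨g, hg, hexp⟩ := hmain l hl hll
  have hl1 : l ≤ 1 := by linarith
  have hw : 4 * l * (G * l) = 4 * G * l ^ 2 := by ring
  have hwexp := exp_le_one_add_mul_sq hG.le hl.le hl1
  rw [one_mul]
  refine ⟨fun f hf N => ?_, fun f B heven hd hfB hdB x => ?_⟩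
  · have h1 := circleHolderNorm_iterate_sub_le hA (fun x => (hexp x).1) (fun x => (hexp x).2)
      (Real.exp_pos _).le hl hg hinv hf N
    rw [hw] at h1
    have hpow : Real.exp (-c * l ^ 3) ^ N = Real.exp (-(c * l ^ 3 * N)) := by
      rw [← Real.exp_nat_mul]; congr 1; ring
    refine ⟨fun hN => h1.trans ?_, h1.trans ?_⟩
    · rw [mul_comm]
      gcongr
      rw [hpow, ← Real.exp_add]
      apply Real.exp_le_exp.2
      have h2 : 8 * G ≤ c * (l * N) := by
        rw [div_le_iff₀ hc] at hN; linarith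
      have h3 := mul_le_mul_of_nonneg_left h2 (sq_nonneg l)
      linarith [show l ^ 2 * (c * (l * N)) = c * l ^ 3 * N by ring]
    · rw [mul_right_comm (ENNReal.ofReal (1 + _))]
      gcongr
      rw [← ENNReal.ofReal_mul (by positivity)]
      apply ENNReal.ofReal_le_ofReal
      rw [hpow]
      refine mul_le_mul ?_ ?_ (Real.exp_pos _).le (by positivity)
      · refine hwexp.trans ?_
        have : 0 ≤ 2 * Real.exp (4 * G) / c * l ^ 2 := by positivity
        linarith
      · apply Real.exp_le_exp.2
        have : 0 ≤ c * l ^ 3 * N := by positivity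
        linarith
  · have hB0 : 0 ≤ B := (norm_nonneg _).trans (hfB x)
    have hlip := norm_sub_le_of_deriv_le heven hd hdB
    have hcont := continuous_of_norm_sub_le hlip
    have hhol : ∀ x y, ‖f x - f y‖ ≤ 2 * B * circleDist x y ^ l := fun x y => by
      have h1 := Real.rpow_le_rpow_of_exponent_ge' (circleDist_nonneg x y)
        (circleDist_le_one x y) hl.le hl1
      rw [Real.rpow_one] at h1
      exact (hlip x y).trans (mul_le_mul_of_nonneg_left h1 (mul_nonneg zero_le_two hB0))
    have hy : 0 < c * l ^ 3 := by positivity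
    have hterm : ∀ m : ℕ, ‖(∫ ω, f (randomOrbit (conjFamily M T l) x ω (m + 1))
        ∂(Measure.infinitePi fun _ : ℕ => p)) - ∫ y, f y ∂ν‖ ≤
        Real.exp (-(c * l ^ 3)) ^ (m + 1) * (2 * Real.exp (4 * G) * B) := by
      intro m
      rw [integral_randomOrbit hA x (m + 1) hcont]
      refine (norm_sub_meanOp_le hA hinv hl.le hcont (by positivity) (m + 1)
        (norm_transferOp_iterate_sub_le hA (fun x => (hexp x).1) (fun x => (hexp x).2)
          (Real.exp_pos _).le hl.le hg hcont (by positivity) hhol (m + 1)) x).trans ?_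
      rw [hw, neg_mul]
      have h2 : Real.exp (4 * G * l ^ 2) ≤ Real.exp (4 * G) :=
        Real.exp_le_exp.2 (mul_le_of_le_one_right (by positivity) (pow_le_one₀ hl.le hl1))
      calc _ ≤ Real.exp (4 * G) * Real.exp (-(c * l ^ 3)) ^ (m + 1) * (2 * B) := by gcongr
        _ = _ := by ring
    obtain ⟨hs, ht⟩ := summable_and_norm_tsum_le (by positivity) hy hterm
    refine ⟨hs, ht.trans ?_⟩
    have h3 : 0 ≤ 4 * G * Real.exp (4 * G) * B * (l ^ 3)⁻¹ := by positivity
    rw [mul_inv]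
    calc _ = 2 * Real.exp (4 * G) / c * B * (l ^ 3)⁻¹ := by ring
      _ ≤ _ := by linarith
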